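/- For $\kappa,\tau\in\mathbb R$ let $\mathcal N_{\kappa,\tau}$ be the open set $\{(x,y,z)\in\mathbb R^3 : F(x,y)>0\}$, $F=1+\frac{\kappa}{4}(x^2+y^2)$, with the Bianchi–Cartan–Vranceanu metric $$g_{\kappa,\tau}=\frac{dx^2+dy^2}{F^2}+\Big(dz+\tau\,\frac{y\,dx-x\,dy}{F}\Big)^2 ,$$ and let $E_3=\partial/\partial z$ be the Hopf vector field. Assume $\kappa\neq 4\tau^2$ (so that $\mathcal N_{\kappa,\tau}$ is not a space form) and $\tau\neq 0$. Let $\varphi:\mathcal M\to\mathcal N_{\kappa,\tau}$ be a smooth immersion of a connected (nonempty) smooth surface, with a smooth unit normal vector field $N$, and equip $\mathcal M$ with the induced metric. Let $A$ be the shape operator, $AX=-\overline\nabla_X N$ with $\overline\nabla$ the Levi-Civita connection of $g_{\kappa,\tau}$, let $f=\operatorname{trace}A$ be the mean curvature function, and let $\alpha\in[0,\pi]$ be the angle between $N$ and $E_3$, $\cos\alpha=g_{\kappa,\tau}(N,E_3)$. The surface is called biconservative if $$2A(\operatorname{grad} f)+f\operatorname{grad} f=2f\,\operatorname{Ricci}(N)^{\top}\quad\text{on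 }\mathcal M,$$ where $\operatorname{Ricci}(N)^\top$ is the tangential component of the Ricci curvature of $\mathcal N_{\kappa,\tau}$ in the direction $N$. Suppose that $\mathcal M$ is a surface of revolution, i.e. it is invariant under the one-parameter group $(R_t)_{t\in\mathbb R}$ of rotations about the $z$-axis: there is a continuous action $(\rho_t)_{t\in\mathbb R}$ of $\mathbb R$ on $\mathcal M$ with $\varphi\circ\rho_t=R_t\circ\varphi$. Suppose that $f\neq0$ and $\alpha\in(0,\pi)$ at every point of $\mathcal M$. Then $\mathcal M$ is biconservative if and only if it is (an open piece of) a Hopf circular cylinder, i.e. there are $R>0$ and an open interval $J\subseteq\mathbb R$, possibly unbounded, with $$\varphi(\mathcal M)=\{(x,y,z) : x^2+y^2=R^2,\ z\in J\}.$$ -/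

import Mathlib

open scoped Manifold ContDiff

noncomputable section

namespace BCV

/-! ### The Bianchi-Cartan-Vranceanu space `N_{κ,τ}`

Points and vectors of `ℝ³` are written in the coordinates `(x, y, z) = (p 0, p 1, p 2)`. The
norm of `Fin 3 → ℝ` plays no role: only its smooth structure is used, and all lengths
and angles are measured with the metric `g_{κ,τ}` below. -/

/-- `ℝ³` as a coordinate space. -/
abbrev R3 : Type := Fin 3 → ℝ

/-- `ℝ²`, the model space of surfaces. -/
abbrev R2 : Type := EuclideanSpace ℝ (Fin 2)

/-- The coordinate vector field `∂/∂x_i` of `ℝ³`. -/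
def coordVec (i : Fin 3) : R3 := Pi.single i 1

/-- The function `F = 1 + (κ/4)(x² + y²)`. -/
def conf (κ : ℝ) (p : R3) : ℝ := 1 + κ / 4 * (p 0 ^ 2 + p 1 ^ 2)

/-- The domain `{F > 0}` on which the metric `g_{κ,τ}` lives. -/
def space (κ : ℝ) : Set R3 := {p | 0 < conf κ p}

/-- The one-form `dz + τ (y dx - x dy) / F`. -/
def contactForm (κ τ : ℝ) (p v : R3) : ℝ :=
  v 2 + τ * (p 1 * v 0 - p 0 * v 1) / conf κ p

/-- The metric `g_{κ,τ} = (dx² + dy²) / F² + (dz + τ (y dx - x dy) / F)²` at `p`, as a bilinear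
form in `v`, `w`. -/
def metric (κ τ : ℝ) (p v w : R3) : ℝ :=
  (v 0 * w 0 + v 1 * w 1) / conf κ p ^ 2 + contactForm κ τ p v * contactForm κ τ p w

/-- The components `g_{ij}` of the metric in the coordinates of `ℝ³`. -/
def metricMatrix (κ τ : ℝ) (p : R3) : Matrix (Fin 3) (Fin 3) ℝ :=
  Matrix.of fun i j => metric κ τ p (coordVec i) (coordVec j)

/-- The partial derivative `∂h/∂x_i`. -/
def partialDeriv (i : Fin 3) (h : R3 → ℝ) (p : R3) : ℝ := fderiv ℝ h p (coordVec i)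

/-- The Christoffel symbol `Γ^k_{ij} = ½ ∑_l g^{kl} (∂_i g_{jl} + ∂_j g_{il} - ∂_l g_{ij})` of the
Levi-Civita connection of `g_{κ,τ}`. -/
def christoffel (κ τ : ℝ) (k i j : Fin 3) (p : R3) : ℝ :=
  1 / 2 * ∑ l, (metricMatrix κ τ p)⁻¹ k l *
    (partialDeriv i (fun q => metricMatrix κ τ q j l) p
      + partialDeriv j (fun q => metricMatrix κ τ q i l) p
      - partialDeriv l (fun q => metricMatrix κ τ q i j) p)

/-- The components of the Ricci tensor of `g_{κ,τ}`,
`Ric_{ij} = ∑_k (∂_k Γ^k_{ij} - ∂_j Γ^k_{ik}) + ∑_{k,l} (Γ^k_{kl} Γ^l_{ij} - Γ^k_{jl} Γ^l_{ik})`. -/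
def ricci (κ τ : ℝ) (p : R3) : Matrix (Fin 3) (Fin 3) ℝ :=
  Matrix.of fun i j =>
    ∑ k, (partialDeriv k (christoffel κ τ k i j) p - partialDeriv j (christoffel κ τ k i k) p)
    + ∑ k, ∑ l, (christoffel κ τ k k l p * christoffel κ τ l i j p
        - christoffel κ τ k j l p * christoffel κ τ l i k p)

/-- The vector `Ricci(v)`, that is, the Ricci tensor with one index raised:
`g(Ricci(v), w) = Ric(v, w)`. -/
def ricciVec (κ τ : ℝ) (p v : R3) : R3 :=
  (metricMatrix κ τ p)⁻¹.mulVec ((ricci κ τ p).mulVec v)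

/-- The rotation by the angle `t` about the `z`-axis. -/
def rotation (t : ℝ) (p : R3) : R3 :=
  ![Real.cos t * p 0 - Real.sin t * p 1, Real.sin t * p 0 + Real.cos t * p 1, p 2]

/-! ### Surfaces in `N_{κ,τ}`

`M` is a smooth surface, `φ : M → ℝ³` an immersion with values in `{F > 0}`, and `ξ : M → ℝ³` is
a vector field along `φ`. Since `T_p ℝ³ = ℝ³`, the vectors `dφ_p(X)` are elements of `ℝ³`. -/

variable {M : Type*} [TopologicalSpace M] [ChartedSpace R2 M]

/-- The differential `dφ_p` of a map `φ : M → ℝ³`. -/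
def diff (φ : M → R3) (p : M) : TangentSpace (𝓡 2) p →L[ℝ] R3 :=
  mfderiv (𝓡 2) 𝓘(ℝ, R3) φ p

/-- The map `φ : M → N_{κ,τ}` is a smooth immersion and `ξ` is a smooth unit normal vector field
along it. -/
structure IsOrientedSurface (κ τ : ℝ) (φ ξ : M → R3) : Prop where
  smooth : ContMDiff (𝓡 2) 𝓘(ℝ, R3) ∞ φ
  mem_space : ∀ p, φ p ∈ space κ
  immersion : ∀ p, Function.Injective (diff φ p)
  smooth_normal : ContMDiff (𝓡 2) 𝓘(ℝ, R3) ∞ ξ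
  unit_normal : ∀ p, metric κ τ (φ p) (ξ p) (ξ p) = 1
  normal : ∀ p (X : TangentSpace (𝓡 2) p), metric κ τ (φ p) (ξ p) (diff φ p X) = 0

/-- The immersed surface `φ : M → N_{κ,τ}` is a surface of revolution: it is invariant under the
one-parameter group of rotations about the `z`-axis, i.e. the rotations lift to a (continuous)
one-parameter group of transformations of `M`. -/
def IsSurfaceOfRevolution (φ : M → R3) : Prop :=
  ∃ ρ : Flow ℝ M, ∀ (t : ℝ) (p : M), φ (ρ t p) = rotation t (φ p)

/-- The standard basis of `T_p M` (the coordinate basis of the preferred chart at `p`). -/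
def tangentBasis (p : M) (i : Fin 2) : TangentSpace (𝓡 2) p :=
  (EuclideanSpace.single i (1 : ℝ) : R2)

/-- The first fundamental form of `φ` in the basis `tangentBasis p`. -/
def firstForm (κ τ : ℝ) (φ : M → R3) (p : M) : Matrix (Fin 2) (Fin 2) ℝ :=
  Matrix.of fun i j =>
    metric κ τ (φ p) (diff φ p (tangentBasis p i)) (diff φ p (tangentBasis p j))

/-- The vector `W` of `T_p M` dual to the linear form with components `c_j` with respect to the
induced metric: `⟨W, ∂_j⟩ = c_j`. -/
def sharp (κ τ : ℝ) (φ : M → R3) (p : M) (c : Fin 2 → ℝ) : TangentSpace (𝓡 2) p :=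
  ∑ i, ((firstForm κ τ φ p)⁻¹.mulVec c) i • tangentBasis p i

/-- The tangent component of a vector `V` of `N_{κ,τ}` at `φ(p)`, as a vector of `T_p M`:
the vector `W` with `g(dφ(W), dφ(Y)) = g(V, dφ(Y))` for all `Y`. -/
def tangentPart (κ τ : ℝ) (φ : M → R3) (p : M) (V : R3) : TangentSpace (𝓡 2) p :=
  sharp κ τ φ p fun j => metric κ τ (φ p) V (diff φ p (tangentBasis p j))

/-- The gradient of a function on `M` with respect to the induced metric. -/
def grad (κ τ : ℝ) (φ : M → R3) (h : M → ℝ) (p : M) : TangentSpace (𝓡 2) p :=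
  sharp κ τ φ p fun j => (mfderiv (𝓡 2) 𝓘(ℝ, ℝ) h p (tangentBasis p j) : ℝ)

/-- The covariant derivative, for the Levi-Civita connection of `g_{κ,τ}`, of the vector
field `ξ` along `φ` in the direction `X`:
`(∇_X ξ)^k = X(ξ^k) + ∑_{i,j} Γ^k_{ij} dφ^i(X) ξ^j`. -/
def covDeriv (κ τ : ℝ) (φ ξ : M → R3) (p : M) (X : TangentSpace (𝓡 2) p) : R3 :=
  fun k => diff ξ p X k + ∑ i, ∑ j, christoffel κ τ k i j (φ p) * diff φ p X i * ξ p j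

theorem tangentPart_add (κ τ : ℝ) (φ : M → R3) (p : M) (V W : R3) :
    tangentPart κ τ φ p (V + W) = tangentPart κ τ φ p V + tangentPart κ τ φ p W := by
  unfold tangentPart sharp
  rw [← Finset.sum_add_distrib]
  refine Finset.sum_congr rfl fun i _ => ?_
  rw [← add_smul, ← Pi.add_apply, ← Matrix.mulVec_add]
  congr 3
  funext j
  simp only [metric, contactForm, Pi.add_apply]
  ring

theorem tangentPart_smul (κ τ : ℝ) (φ : M → R3) (p : M) (a : ℝ) (V : R3) :
    tangentPart κ τ φ p (a • V) = a • tangentPart κ τ φ p V := by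
  unfold tangentPart sharp
  rw [Finset.smul_sum]
  refine Finset.sum_congr rfl fun i _ => ?_
  rw [smul_smul]
  congr 1
  rw [← smul_eq_mul]
  refine Eq.trans ?_ (congrFun (Matrix.mulVec_smul (firstForm κ τ φ p)⁻¹ a _) i)
  congr 2
  funext j
  simp only [metric, contactForm, Pi.smul_apply, smul_eq_mul]
  ring

theorem covDeriv_add (κ τ : ℝ) (φ ξ : M → R3) (p : M) (X Y : TangentSpace (𝓡 2) p) :
    covDeriv κ τ φ ξ p (X + Y) = covDeriv κ τ φ ξ p X + covDeriv κ τ φ ξ p Y := by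
  funext k
  simp only [covDeriv, map_add, Pi.add_apply, mul_add, add_mul, Finset.sum_add_distrib]
  ring

theorem covDeriv_smul (κ τ : ℝ) (φ ξ : M → R3) (p : M) (a : ℝ) (X : TangentSpace (𝓡 2) p) :
    covDeriv κ τ φ ξ p (a • X) = a • covDeriv κ τ φ ξ p X := by
  funext k
  simp only [covDeriv, map_smul, Pi.smul_apply, smul_eq_mul, mul_add, Finset.mul_sum]
  congr 1
  refine Finset.sum_congr rfl fun i _ => Finset.sum_congr rfl fun j _ => ?_
  ring

/-- The shape operator `A X = -∇_X ξ` of the surface with unit normal `ξ`. -/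
def shapeOperator (κ τ : ℝ) (φ ξ : M → R3) (p : M) :
    TangentSpace (𝓡 2) p →ₗ[ℝ] TangentSpace (𝓡 2) p where
  toFun X := tangentPart κ τ φ p (-covDeriv κ τ φ ξ p X)
  map_add' X Y := by rw [covDeriv_add, neg_add, tangentPart_add]
  map_smul' a X := by rw [covDeriv_smul, ← smul_neg, tangentPart_smul]; rfl

/-- The mean curvature function `f = trace A`. -/
def meanCurvature (κ τ : ℝ) (φ ξ : M → R3) (p : M) : ℝ :=
  LinearMap.trace ℝ (TangentSpace (𝓡 2) p) (shapeOperator κ τ φ ξ p)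

/-- The angle `α ∈ [0, π]` between the unit normal `ξ` and the Hopf vector field
`E₃ = ∂/∂z`. -/
def angle (κ τ : ℝ) (φ ξ : M → R3) (p : M) : ℝ :=
  Real.arccos (metric κ τ (φ p) (coordVec 2) (ξ p))

/-- The surface is biconservative: `2 A(grad f) + f grad f = 2 f Ricci(ξ)^⊤`. -/
def IsBiconservative (κ τ : ℝ) (φ ξ : M → R3) : Prop :=
  ∀ p : M,
    (2 : ℝ) • shapeOperator κ τ φ ξ p (grad κ τ φ (meanCurvature κ τ φ ξ) p)
        + meanCurvature κ τ φ ξ p • grad κ τ φ (meanCurvature κ τ φ ξ) p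
      = (2 * meanCurvature κ τ φ ξ p) • tangentPart κ τ φ p (ricciVec κ τ (φ p) (ξ p))

/-- The surface is (a piece `J` high of) a Hopf circular cylinder: the image of `φ` consists of
the points over a circle `x² + y² = R²` of the base of the Hopf fibration `(x, y, z) ↦ (x, y)`
whose height `z` belongs to an open interval `J`, possibly unbounded. -/
def IsHopfCircularCylinder (φ : M → R3) : Prop :=
  ∃ R : ℝ, 0 < R ∧ ∃ J : Set ℝ, IsOpen J ∧ J.OrdConnected ∧
    Set.range φ = {q : R3 | q 0 ^ 2 + q 1 ^ 2 = R ^ 2 ∧ q 2 ∈ J}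

end BCV

end

/-!
A surface of revolution that is nowhere horizontal does not meet the axis: a point on the axis would
be fixed by the flow, so its normal would be invariant under rotations, hence vertical
(`IsOrientedSurface.radiusSq_pos`). Away from the axis the tangent plane is spanned by the rotation
field and by an orthogonal meridian vector, and, with `s = x² + y²`, the unit normal has the form
`normalVec` with two invariant coefficients, `μ` (`radialPart`) and `c = cos α` (`hopfPart`), subject
to `s μ² + c² (1 + τ² s) = 1`. The Koszul formula gives the second fundamental form in this frame explicitly in
terms of `μ`, `c` and their derivatives `μ'`, `c'` along the meridian. In particular
`f = μ c' - c μ' - μ F c² - μ (1 - κ s / 4)` (`IsOrientedSurface.meanCurvature_eq`), so that `f` is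
rotation-invariant and `grad f` points along the meridian, while the mixed term of the second
fundamental form is `τ (4 τ² - κ)` times a positive function.

As `Ricci(ξ)` equals `(4 τ² - κ) cos α E₃` up to a multiple of `ξ`, and `g(E₃, ·)` on the rotation
field is `-τ s / F`, the nonzero factor `τ (4 τ² - κ)` cancels in the
component of the biconservative equation along the parallel, leaving `f' = -4 f c (1 + τ² s)`. The
component along the meridian then becomes `f = -(2/3) μ` wherever `c ≠ 0`
(`IsOrientedSurface.biconservative_system`). If `c ≠ 0` at a point, this holds nearby and may be
differentiated; the derivatives `μ'` and `c'` obtained in this way contradict the formula for `f`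
(`IsOrientedSurface.hopfPart_eq_zero`). Hence `c = 0`: the Hopf field is tangent to the surface,
`x² + y²` is constant, and the height has no critical points, so that its image is an open interval.

Conversely, on a circular cylinder `c = 0`, `μ` and `f` are locally constant, and `Ricci(ξ)` is
normal: both sides of the biconservative equation vanish.
-/

noncomputable section

namespace BCV

/-! ### The Levi-Civita connection and the Ricci tensor in coordinates -/

/-- The common shape of the components of the metric and of the Christoffel symbols:
a polynomial in `x`, `y` and `1 / F`. -/
def rationalForm (κ a b k c d e s : ℝ) (q : R3) : ℝ :=
  (a * q 0 + b * q 1) * (conf κ q)⁻¹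
    + (k + c * (q 0 * q 1) + d * q 0 ^ 2 + e * q 1 ^ 2) * (conf κ q)⁻¹ ^ 2 + s

theorem isOpen_space (κ : ℝ) : IsOpen (space κ) := by
  have h : Continuous (conf κ) := by unfold conf; fun_prop
  exact isOpen_lt continuous_const h

theorem hasFDerivAt_coord (i : Fin 3) (p : R3) :
    HasFDerivAt (fun q : R3 => q i) (ContinuousLinearMap.proj (R := ℝ) (φ := fun _ => ℝ) i) p :=
  (ContinuousLinearMap.proj (R := ℝ) (φ := fun _ : Fin 3 => ℝ) i).hasFDerivAt

theorem fderiv_conf_inv (κ : ℝ) {p : R3} (hp : p ∈ space κ) :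
    ∃ L : R3 →L[ℝ] ℝ, HasFDerivAt (fun q => (conf κ q)⁻¹) L p ∧
      ∀ v, L v = -(κ / 2 * (p 0 * v 0 + p 1 * v 1)) * (conf κ p)⁻¹ ^ 2 := by
  have hF : conf κ p ≠ 0 := ne_of_gt hp
  have h : HasFDerivAt (conf κ) _ p :=
    ((((hasFDerivAt_coord 0 p).pow 2).add ((hasFDerivAt_coord 1 p).pow 2)).const_mul
      (κ / 4)).const_add 1
  refine ⟨_, (hasDerivAt_inv hF).comp_hasFDerivAt p h, fun v => ?_⟩
  simp
  field_simp
  ring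

theorem fderiv_rationalForm {κ a b k c d e s : ℝ} {p : R3} (hp : p ∈ space κ) (v : R3) :
    fderiv ℝ (rationalForm κ a b k c d e s) p v
      = (a * v 0 + b * v 1) * (conf κ p)⁻¹
        + (c * (v 0 * p 1 + p 0 * v 1) + 2 * d * p 0 * v 0 + 2 * e * p 1 * v 1)
          * (conf κ p)⁻¹ ^ 2
        - (κ / 2 * (p 0 * v 0 + p 1 * v 1)) * (conf κ p)⁻¹ ^ 2
          * ((a * p 0 + b * p 1) + 2 * (k + c * (p 0 * p 1) + d * p 0 ^ 2 + e * p 1 ^ 2)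
            * (conf κ p)⁻¹) := by
  obtain ⟨L, hL, hLv⟩ := fderiv_conf_inv κ hp
  have hx := hasFDerivAt_coord 0 p
  have hy := hasFDerivAt_coord 1 p
  have h : HasFDerivAt (rationalForm κ a b k c d e s) _ p :=
    (((((hx.const_mul a).add (hy.const_mul b)).mul hL).add
      ((((((hx.mul hy).const_mul c).const_add k).add ((hx.pow 2).const_mul d)).add
        ((hy.pow 2).const_mul e)).mul (hL.pow 2))).add_const s)
  rw [h.fderiv]
  simp [hLv]
  ring

theorem metricMatrix_apply_eq (κ τ : ℝ) (i j : Fin 3) :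
    (fun q => metricMatrix κ τ q i j) =
      (![![rationalForm κ 0 0 1 0 0 (τ ^ 2) 0, rationalForm κ 0 0 0 (-τ ^ 2) 0 0 0,
            rationalForm κ 0 τ 0 0 0 0 0],
        ![rationalForm κ 0 0 0 (-τ ^ 2) 0 0 0, rationalForm κ 0 0 1 0 (τ ^ 2) 0 0,
            rationalForm κ (-τ) 0 0 0 0 0 0],
        ![rationalForm κ 0 τ 0 0 0 0 0, rationalForm κ (-τ) 0 0 0 0 0 0,
            rationalForm κ 0 0 0 0 0 0 1]] : Fin 3 → Fin 3 → R3 → ℝ) i j := by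
  funext q
  fin_cases i <;> fin_cases j <;>
    simp [metricMatrix, metric, contactForm, coordVec, rationalForm, div_eq_mul_inv] <;> ring

/-- The inverse of the metric, in terms of the orthonormal frame
`F ∂_x - τ y ∂_z`, `F ∂_y + τ x ∂_z`, `∂_z`. -/
theorem metricMatrix_inv (κ τ : ℝ) {p : R3} (hp : p ∈ space κ) :
    (metricMatrix κ τ p)⁻¹ =
      !![conf κ p ^ 2, 0, -(τ * p 1 * conf κ p);
        0, conf κ p ^ 2, τ * p 0 * conf κ p;
        -(τ * p 1 * conf κ p), τ * p 0 * conf κ p, 1 + τ ^ 2 * (p 0 ^ 2 + p 1 ^ 2)] := by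
  have hF : conf κ p ≠ 0 := ne_of_gt hp
  refine Matrix.inv_eq_right_inv ?_
  ext i j
  fin_cases i <;> fin_cases j <;>
    simp [metricMatrix, metric, contactForm, coordVec, Matrix.mul_apply, Fin.sum_univ_three] <;>
    field_simp <;> ring

/-- Closed forms of the Christoffel symbols `Γ^k_{ij}`. -/
def christoffelTable (κ τ : ℝ) : Fin 3 → Fin 3 → Fin 3 → R3 → ℝ :=
  ![![![rationalForm κ (-κ / 2) 0 0 0 0 0 0, rationalForm κ 0 (τ ^ 2 - κ / 2) 0 0 0 0 0,
            rationalForm κ 0 0 0 0 0 0 0],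
        ![rationalForm κ 0 (τ ^ 2 - κ / 2) 0 0 0 0 0,
            rationalForm κ (κ / 2 - 2 * τ ^ 2) 0 0 0 0 0 0, rationalForm κ 0 0 0 0 0 0 τ],
        ![rationalForm κ 0 0 0 0 0 0 0, rationalForm κ 0 0 0 0 0 0 τ,
            rationalForm κ 0 0 0 0 0 0 0]],
      ![![rationalForm κ 0 (κ / 2 - 2 * τ ^ 2) 0 0 0 0 0,
            rationalForm κ (τ ^ 2 - κ / 2) 0 0 0 0 0 0, rationalForm κ 0 0 0 0 0 0 (-τ)],
        ![rationalForm κ (τ ^ 2 - κ / 2) 0 0 0 0 0 0,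
            rationalForm κ 0 (-κ / 2) 0 0 0 0 0, rationalForm κ 0 0 0 0 0 0 0],
        ![rationalForm κ 0 0 0 0 0 0 (-τ), rationalForm κ 0 0 0 0 0 0 0,
            rationalForm κ 0 0 0 0 0 0 0]],
      ![![rationalForm κ 0 0 0 (τ * (κ / 2 - 2 * τ ^ 2)) 0 0 0,
            rationalForm κ 0 0 0 0 (τ * (τ ^ 2 - κ / 4)) (-τ * (τ ^ 2 - κ / 4)) 0,
            rationalForm κ (-τ ^ 2) 0 0 0 0 0 0],
        ![rationalForm κ 0 0 0 0 (τ * (τ ^ 2 - κ / 4)) (-τ * (τ ^ 2 - κ / 4)) 0,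
            rationalForm κ 0 0 0 (-τ * (κ / 2 - 2 * τ ^ 2)) 0 0 0,
            rationalForm κ 0 (-τ ^ 2) 0 0 0 0 0],
        ![rationalForm κ (-τ ^ 2) 0 0 0 0 0 0, rationalForm κ 0 (-τ ^ 2) 0 0 0 0 0,
            rationalForm κ 0 0 0 0 0 0 0]]]

theorem christoffel_eq (κ τ : ℝ) {p : R3} (hp : p ∈ space κ) (k i j : Fin 3) :
    christoffel κ τ k i j p =
      christoffelTable κ τ k i j p := by
  have hF : conf κ p ≠ 0 := ne_of_gt hp
  have hF' : conf κ p = 1 + κ / 4 * (p 0 ^ 2 + p 1 ^ 2) := rfl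
  simp only [christoffel, partialDeriv, metricMatrix_inv κ τ hp, metricMatrix_apply_eq,
    Fin.sum_univ_three]
  fin_cases k <;> fin_cases i <;> fin_cases j <;>
    simp [christoffelTable, fderiv_rationalForm hp, coordVec] <;>
    simp only [rationalForm] <;> field_simp <;> simp only [hF'] <;> ring

theorem partialDeriv_christoffel (κ τ : ℝ) {p : R3} (hp : p ∈ space κ) (l k i j : Fin 3) :
    partialDeriv l (christoffel κ τ k i j) p
      = fderiv ℝ (christoffelTable κ τ k i j) p (coordVec l) := by
  have h : christoffel κ τ k i j =ᶠ[nhds p] christoffelTable κ τ k i j := by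
    filter_upwards [(isOpen_space κ).mem_nhds hp] with q hq
    exact christoffel_eq κ τ hq k i j
  rw [partialDeriv, h.fderiv_eq]

/-- `Ric = (κ - 2τ²) g + (4τ² - κ) η ⊗ η`, where `η` is the contact form. -/
theorem ricci_eq (κ τ : ℝ) {p : R3} (hp : p ∈ space κ) (i j : Fin 3) :
    ricci κ τ p i j = (κ - 2 * τ ^ 2) * metric κ τ p (coordVec i) (coordVec j)
      + (4 * τ ^ 2 - κ) * (contactForm κ τ p (coordVec i) * contactForm κ τ p (coordVec j)) := by
  have hF : conf κ p ≠ 0 := ne_of_gt hp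
  have hF' : conf κ p = 1 + κ / 4 * (p 0 ^ 2 + p 1 ^ 2) := rfl
  simp only [ricci, Matrix.of_apply, partialDeriv_christoffel κ τ hp, christoffel_eq κ τ hp,
    Fin.sum_univ_three]
  fin_cases i <;> fin_cases j <;>
    simp [christoffelTable, fderiv_rationalForm hp, coordVec, metric, contactForm] <;>
    simp only [rationalForm] <;> field_simp <;> simp only [hF'] <;> ring

theorem metric_eq_sum (κ τ : ℝ) (p v w : R3) :
    metric κ τ p v w = ∑ i, ∑ j, w i * (metricMatrix κ τ p i j * v j) := by
  simp [metricMatrix, metric, contactForm, coordVec, Fin.sum_univ_three]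
  ring

theorem det_metricMatrix_isUnit (κ τ : ℝ) {p : R3} (hp : p ∈ space κ) :
    IsUnit (metricMatrix κ τ p).det := by
  have hF : conf κ p ≠ 0 := ne_of_gt hp
  rw [isUnit_iff_ne_zero, Matrix.det_fin_three]
  simp only [metricMatrix, metric, contactForm, coordVec, Matrix.of_apply]
  simp
  field_simp
  ring_nf
  simp

/-- Lowering an index that was raised with the inverse matrix of the metric. -/
theorem metric_inv_mulVec (κ τ : ℝ) {p : R3} (hp : p ∈ space κ) (c w : R3) :
    metric κ τ p ((metricMatrix κ τ p)⁻¹.mulVec c) w = ∑ l, w l * c l := by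
  have h : (metricMatrix κ τ p).mulVec ((metricMatrix κ τ p)⁻¹.mulVec c) = c := by
    rw [Matrix.mulVec_mulVec, Matrix.mul_nonsing_inv _ (det_metricMatrix_isUnit κ τ hp),
      Matrix.one_mulVec]
  rw [metric_eq_sum]
  refine Finset.sum_congr rfl fun i _ => ?_
  rw [← Finset.mul_sum]
  congr 1
  exact congrFun h i

theorem metric_ricciVec (κ τ : ℝ) {p : R3} (hp : p ∈ space κ) (v w : R3) :
    metric κ τ p (ricciVec κ τ p v) w = (κ - 2 * τ ^ 2) * metric κ τ p v w
      + (4 * τ ^ 2 - κ) * (contactForm κ τ p v * contactForm κ τ p w) := by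
  rw [ricciVec, metric_inv_mulVec κ τ hp]
  simp only [Matrix.mulVec, dotProduct, ricci_eq κ τ hp, Fin.sum_univ_three]
  simp [metric, contactForm, coordVec]
  ring

/-- The derivative `(D_u g)(v, w)` of the components of the metric in the direction `u`. -/
def metricDeriv (κ τ : ℝ) (p u v w : R3) : ℝ :=
  -(κ * (p 0 * u 0 + p 1 * u 1) * (conf κ p)⁻¹ ^ 3) * (v 0 * w 0 + v 1 * w 1)
    + (τ * (u 1 * v 0 - u 0 * v 1) * (conf κ p)⁻¹
        - τ * (p 1 * v 0 - p 0 * v 1) * (κ / 2 * (p 0 * u 0 + p 1 * u 1)) * (conf κ p)⁻¹ ^ 2)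
      * contactForm κ τ p w
    + contactForm κ τ p v * (τ * (u 1 * w 0 - u 0 * w 1) * (conf κ p)⁻¹
        - τ * (p 1 * w 0 - p 0 * w 1) * (κ / 2 * (p 0 * u 0 + p 1 * u 1)) * (conf κ p)⁻¹ ^ 2)

/-- The Koszul formula: `g(Γ(v, ξ), w) = ½ ((D_v g)(ξ, w) + (D_ξ g)(v, w) - (D_w g)(v, ξ))`. -/
theorem metric_christoffel (κ τ : ℝ) {p : R3} (hp : p ∈ space κ) (v u w : R3) :
    metric κ τ p (fun k => ∑ i, ∑ j, christoffel κ τ k i j p * v i * u j) w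
      = 1 / 2 * (metricDeriv κ τ p v u w + metricDeriv κ τ p u v w
          - metricDeriv κ τ p w v u) := by
  have hF : conf κ p ≠ 0 := ne_of_gt hp
  have hF' : conf κ p = 1 + κ / 4 * (p 0 ^ 2 + p 1 ^ 2) := rfl
  simp only [christoffel_eq κ τ hp, Fin.sum_univ_three]
  simp [christoffelTable, metricDeriv, metric, contactForm]
  simp only [rationalForm]
  field_simp
  simp only [hF']
  ring

section TangentPlane

/-! ### The metric as an inner product, and the linear algebra of the tangent plane -/

theorem metric_comm (κ τ : ℝ) (p v w : R3) : metric κ τ p v w = metric κ τ p w v := by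
  simp only [metric]
  ring

theorem metric_add_left (κ τ : ℝ) (p v w u : R3) :
    metric κ τ p (v + w) u = metric κ τ p v u + metric κ τ p w u := by
  simp only [metric, contactForm, Pi.add_apply]
  ring

theorem metric_smul_left (κ τ : ℝ) (p : R3) (a : ℝ) (v u : R3) :
    metric κ τ p (a • v) u = a * metric κ τ p v u := by
  simp only [metric, contactForm, Pi.smul_apply, smul_eq_mul]
  ring

theorem metric_neg_left (κ τ : ℝ) (p v u : R3) :
    metric κ τ p (-v) u = -metric κ τ p v u := by
  rw [← neg_one_smul ℝ v, metric_smul_left]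
  ring

theorem metric_add_right (κ τ : ℝ) (p u v w : R3) :
    metric κ τ p u (v + w) = metric κ τ p u v + metric κ τ p u w := by
  simp only [metric_comm κ τ p u, metric_add_left]

theorem metric_smul_right (κ τ : ℝ) (p : R3) (a : ℝ) (u v : R3) :
    metric κ τ p u (a • v) = a * metric κ τ p u v := by
  simp only [metric_comm κ τ p u, metric_smul_left]

theorem metric_zero_left (κ τ : ℝ) (p v : R3) : metric κ τ p 0 v = 0 := by
  simp [metric, contactForm]

theorem eq_zero_of_metric_self (κ τ : ℝ) {p v : R3} (hp : p ∈ space κ)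
    (hv : metric κ τ p v v = 0) : v = 0 := by
  have hF : conf κ p ≠ 0 := ne_of_gt hp
  have h1 : 0 ≤ (v 0 * v 0 + v 1 * v 1) / conf κ p ^ 2 :=
    div_nonneg (add_nonneg (mul_self_nonneg _) (mul_self_nonneg _)) (sq_nonneg _)
  have h2 : 0 ≤ contactForm κ τ p v * contactForm κ τ p v := mul_self_nonneg _
  have h3 : v 0 * v 0 + v 1 * v 1 = 0 := by
    have h : (v 0 * v 0 + v 1 * v 1) / conf κ p ^ 2 = 0 := by
      unfold metric at hv
      linarith
    rcases div_eq_zero_iff.1 h with h | h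
    · exact h
    · exact absurd h (pow_ne_zero 2 hF)
  have h4 : contactForm κ τ p v = 0 := by
    unfold metric at hv
    exact mul_self_eq_zero.1 (by linarith)
  have h0 : v 0 = 0 := by nlinarith [mul_self_nonneg (v 0), mul_self_nonneg (v 1)]
  have h1 : v 1 = 0 := by nlinarith [mul_self_nonneg (v 0), mul_self_nonneg (v 1)]
  have h2 : v 2 = 0 := by simpa [contactForm, h0, h1] using h4
  funext i
  fin_cases i <;> assumption

variable {M : Type*} [TopologicalSpace M] [ChartedSpace R2 M]

/-- The derivative of a real function on `M` in the direction `X`. -/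
def dirDeriv (h : M → ℝ) (p : M) (X : TangentSpace (𝓡 2) p) : ℝ :=
  mfderiv (𝓡 2) 𝓘(ℝ, ℝ) h p X

theorem sum_tangentBasis (p : M) (X : TangentSpace (𝓡 2) p) :
    X = ∑ i, (show R2 from X) i • tangentBasis p i := by
  change (show R2 from X) = ∑ i, (show R2 from X) i • (EuclideanSpace.single i (1 : ℝ) : R2)
  ext j
  fin_cases j <;> simp

section Immersion

variable {κ τ : ℝ} {φ ξ : M → R3}

theorem metric_diff_sum (p : M) (c : Fin 2 → ℝ) (v : R3) :
    metric κ τ (φ p) (diff φ p (∑ i, c i • tangentBasis p i)) v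
      = ∑ i, c i * metric κ τ (φ p) (diff φ p (tangentBasis p i)) v := by
  simp only [Fin.sum_univ_two, map_add, map_smul, metric_add_left, metric_smul_left]

theorem sum_tangentBasis_eq_zero (p : M) {c : Fin 2 → ℝ}
    (h : ∑ i, c i • tangentBasis p i = 0) : c = 0 := by
  have h' : (∑ i, c i • (EuclideanSpace.single i (1 : ℝ) : R2)) = 0 := h
  funext j
  have := congrArg (fun v : R2 => v j) h'
  fin_cases j <;> simpa using this

theorem IsOrientedSurface.isUnit_firstForm (hM : IsOrientedSurface κ τ φ ξ) (p : M) :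
    IsUnit (firstForm κ τ φ p).det := by
  rw [isUnit_iff_ne_zero]
  intro h0
  obtain ⟨c, hc, h⟩ := Matrix.exists_mulVec_eq_zero_iff.2 h0
  have h1 : metric κ τ (φ p) (diff φ p (∑ i, c i • tangentBasis p i))
      (diff φ p (∑ i, c i • tangentBasis p i)) = 0 := by
    rw [metric_diff_sum]
    refine Finset.sum_eq_zero fun i _ => ?_
    rw [metric_comm, metric_diff_sum]
    have := congrFun h i
    simp only [Matrix.mulVec, dotProduct, firstForm, Matrix.of_apply, Pi.zero_apply] at this
    rw [show ∑ j, c j * metric κ τ (φ p) (diff φ p (tangentBasis p j))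
        (diff φ p (tangentBasis p i)) = 0 from ?_, mul_zero]
    rw [← this]
    exact Finset.sum_congr rfl fun j _ => by rw [mul_comm, metric_comm]
  have h2 := eq_zero_of_metric_self κ τ (hM.mem_space p) h1
  have h3 := hM.immersion p (h2.trans (map_zero _).symm)
  exact hc (sum_tangentBasis_eq_zero p h3)

/-- `sharp` raises the index of a linear form. -/
theorem IsOrientedSurface.metric_sharp (hM : IsOrientedSurface κ τ φ ξ) (p : M)
    (l : TangentSpace (𝓡 2) p →ₗ[ℝ] ℝ) (Y : TangentSpace (𝓡 2) p) :
    metric κ τ (φ p) (diff φ p (sharp κ τ φ p fun j => l (tangentBasis p j))) (diff φ p Y)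
      = l Y := by
  have h : ∀ j, metric κ τ (φ p) (diff φ p (sharp κ τ φ p fun j => l (tangentBasis p j)))
      (diff φ p (tangentBasis p j)) = l (tangentBasis p j) := by
    intro j
    have h1 : (firstForm κ τ φ p).mulVec ((firstForm κ τ φ p)⁻¹.mulVec
        fun j => l (tangentBasis p j)) = fun j => l (tangentBasis p j) := by
      rw [Matrix.mulVec_mulVec, Matrix.mul_nonsing_inv _ (hM.isUnit_firstForm p),
        Matrix.one_mulVec]
    rw [sharp, metric_diff_sum]
    refine Eq.trans ?_ (congrFun h1 j)
    rw [Matrix.mulVec, dotProduct]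
    exact Finset.sum_congr rfl fun i _ => by rw [mul_comm, firstForm, Matrix.of_apply, metric_comm]
  rw [sum_tangentBasis p Y]
  rw [metric_comm, metric_diff_sum, map_sum]
  refine Finset.sum_congr rfl fun i _ => ?_
  rw [metric_comm, h, map_smul, smul_eq_mul]

theorem IsOrientedSurface.metric_tangentPart (hM : IsOrientedSurface κ τ φ ξ) (p : M)
    (V : R3) (Y : TangentSpace (𝓡 2) p) :
    metric κ τ (φ p) (diff φ p (tangentPart κ τ φ p V)) (diff φ p Y)
      = metric κ τ (φ p) V (diff φ p Y) := by
  let l : TangentSpace (𝓡 2) p →ₗ[ℝ] ℝ :=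
    { toFun := fun Y => metric κ τ (φ p) V (diff φ p Y)
      map_add' := fun X Y => by rw [map_add, metric_add_right]
      map_smul' := fun a X => by rw [map_smul, metric_smul_right]; rfl }
  exact hM.metric_sharp p l Y

theorem IsOrientedSurface.metric_grad (hM : IsOrientedSurface κ τ φ ξ) (h : M → ℝ) (p : M)
    (Y : TangentSpace (𝓡 2) p) :
    metric κ τ (φ p) (diff φ p (grad κ τ φ h p)) (diff φ p Y)
      = dirDeriv h p Y :=
  hM.metric_sharp p
    (mfderiv (𝓡 2) 𝓘(ℝ, ℝ) h p : TangentSpace (𝓡 2) p →L[ℝ] ℝ).toLinearMap Y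

theorem IsOrientedSurface.metric_shapeOperator (hM : IsOrientedSurface κ τ φ ξ) (p : M)
    (X Y : TangentSpace (𝓡 2) p) :
    metric κ τ (φ p) (diff φ p (shapeOperator κ τ φ ξ p X)) (diff φ p Y)
      = -metric κ τ (φ p) (covDeriv κ τ φ ξ p X) (diff φ p Y) := by
  rw [← metric_neg_left]
  exact hM.metric_tangentPart p _ Y

theorem finrank_tangentSpace (p : M) : Module.finrank ℝ (TangentSpace (𝓡 2) p) = 2 := by
  change Module.finrank ℝ R2 = 2
  simp

/-- Two orthogonal vectors of nonzero length span the tangent plane. -/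
theorem exists_eq_of_orthogonal {p : M} {e₁ e₂ : TangentSpace (𝓡 2) p}
    (h₁ : metric κ τ (φ p) (diff φ p e₁) (diff φ p e₁) ≠ 0)
    (h₂ : metric κ τ (φ p) (diff φ p e₂) (diff φ p e₂) ≠ 0)
    (h₁₂ : metric κ τ (φ p) (diff φ p e₁) (diff φ p e₂) = 0) :
    ∃ b : Module.Basis (Fin 2) ℝ (TangentSpace (𝓡 2) p), b 0 = e₁ ∧ b 1 = e₂ := by
  have hli : LinearIndependent ℝ ![e₁, e₂] := by
    rw [LinearIndependent.pair_iff]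
    intro s t hst
    have h : s • diff φ p e₁ + t • diff φ p e₂ = 0 := by
      rw [← map_smul, ← map_smul, ← map_add, hst, map_zero]
    constructor
    · have := congrArg (fun v => metric κ τ (φ p) v (diff φ p e₁)) h
      simp only [metric_add_left, metric_smul_left, metric_comm κ τ _ (diff φ p e₂), h₁₂,
        metric_zero_left] at this
      simpa [h₁] using this
    · have := congrArg (fun v => metric κ τ (φ p) v (diff φ p e₂)) h
      simp only [metric_add_left, metric_smul_left, h₁₂,
        metric_zero_left] at this
      simpa [h₂] using this
  refine ⟨basisOfLinearIndependentOfCardEqFinrank hli (by simp [finrank_tangentSpace]), ?_, ?_⟩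
    <;> simp

theorem diff_eq_repr {p : M} (b : Module.Basis (Fin 2) ℝ (TangentSpace (𝓡 2) p))
    (X : TangentSpace (𝓡 2) p) :
    diff φ p X = b.repr X 0 • diff φ p (b 0) + b.repr X 1 • diff φ p (b 1) := by
  have h := congrArg (diff φ p) (b.sum_repr X)
  rw [Fin.sum_univ_two, map_add, map_smul, map_smul] at h
  exact h.symm

theorem trace_eq_of_orthogonal {p : M} {e₁ e₂ : TangentSpace (𝓡 2) p}
    (h₁ : metric κ τ (φ p) (diff φ p e₁) (diff φ p e₁) ≠ 0)
    (h₂ : metric κ τ (φ p) (diff φ p e₂) (diff φ p e₂) ≠ 0)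
    (h₁₂ : metric κ τ (φ p) (diff φ p e₁) (diff φ p e₂) = 0)
    (A : TangentSpace (𝓡 2) p →ₗ[ℝ] TangentSpace (𝓡 2) p) :
    LinearMap.trace ℝ (TangentSpace (𝓡 2) p) A
      = metric κ τ (φ p) (diff φ p (A e₁)) (diff φ p e₁)
          / metric κ τ (φ p) (diff φ p e₁) (diff φ p e₁)
        + metric κ τ (φ p) (diff φ p (A e₂)) (diff φ p e₂)
          / metric κ τ (φ p) (diff φ p e₂) (diff φ p e₂) := by
  obtain ⟨b, rfl, rfl⟩ := exists_eq_of_orthogonal h₁ h₂ h₁₂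
  have hb := diff_eq_repr (φ := φ) b
  rw [LinearMap.trace_eq_matrix_trace ℝ b, Matrix.trace_fin_two]
  simp only [LinearMap.toMatrix_apply]
  rw [hb (A (b 0)), hb (A (b 1))]
  simp only [metric_add_left, metric_smul_left, metric_comm κ τ _ (diff φ p (b 1)) (diff φ p (b 0)),
    h₁₂]
  field_simp
  ring

/-- A tangent vector orthogonal to both vectors of an orthogonal frame vanishes. -/
theorem IsOrientedSurface.eq_of_metric_eq (hM : IsOrientedSurface κ τ φ ξ) {p : M}
    {e₁ e₂ : TangentSpace (𝓡 2) p}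
    (h₁ : metric κ τ (φ p) (diff φ p e₁) (diff φ p e₁) ≠ 0)
    (h₂ : metric κ τ (φ p) (diff φ p e₂) (diff φ p e₂) ≠ 0)
    (h₁₂ : metric κ τ (φ p) (diff φ p e₁) (diff φ p e₂) = 0)
    {X Y : TangentSpace (𝓡 2) p}
    (hX₁ : metric κ τ (φ p) (diff φ p X) (diff φ p e₁)
      = metric κ τ (φ p) (diff φ p Y) (diff φ p e₁))
    (hX₂ : metric κ τ (φ p) (diff φ p X) (diff φ p e₂)
      = metric κ τ (φ p) (diff φ p Y) (diff φ p e₂)) : X = Y := by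
  obtain ⟨b, rfl, rfl⟩ := exists_eq_of_orthogonal h₁ h₂ h₁₂
  have hb := diff_eq_repr (φ := φ) b
  rw [hb X, hb Y] at hX₁ hX₂
  simp only [metric_add_left, metric_smul_left, metric_comm κ τ _ (diff φ p (b 1)) (diff φ p (b 0)),
    h₁₂, mul_zero, add_zero, zero_add] at hX₁ hX₂
  apply hM.immersion p
  rw [hb X, hb Y, mul_right_cancel₀ h₁ hX₁, mul_right_cancel₀ h₂ hX₂]

/-- The tangent plane is the orthogonal complement of the normal. -/
theorem IsOrientedSurface.exists_diff_eq (hM : IsOrientedSurface κ τ φ ξ) (p : M) {v : R3}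
    (hv : metric κ τ (φ p) (ξ p) v = 0) : ∃ X, diff φ p X = v := by
  let n : R3 →ₗ[ℝ] ℝ :=
    { toFun := fun w => metric κ τ (φ p) (ξ p) w
      map_add' := fun X Y => metric_add_right κ τ _ _ _ _
      map_smul' := fun a X => metric_smul_right κ τ _ _ _ _ }
  let d : R2 →ₗ[ℝ] R3 := (diff φ p).toLinearMap
  have hd : Function.Injective d := hM.immersion p
  have hle : LinearMap.range d ≤ LinearMap.ker n := by
    rintro _ ⟨X, rfl⟩
    exact hM.normal p X
  have h1 : Module.finrank ℝ (LinearMap.range d) = 2 := by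
    rw [LinearMap.finrank_range_of_inj hd]
    simp
  have h2 : Module.finrank ℝ (LinearMap.range n) + Module.finrank ℝ (LinearMap.ker n) = 3 := by
    rw [LinearMap.finrank_range_add_finrank_ker]
    simp
  have h3 : LinearMap.range n = ⊤ := by
    rw [LinearMap.range_eq_top]
    intro a
    refine ⟨a • ξ p, ?_⟩
    rw [map_smul]
    change a • metric κ τ (φ p) (ξ p) (ξ p) = a
    rw [hM.unit_normal, smul_eq_mul, mul_one]
  have h4 : Module.finrank ℝ (LinearMap.range n) = 1 := by
    rw [h3, finrank_top]
    simp
  have h5 : LinearMap.range d = LinearMap.ker n :=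
    Submodule.eq_of_le_of_finrank_eq hle (by omega)
  have h6 : v ∈ LinearMap.range d := by
    rw [h5]
    exact hv
  exact h6

end Immersion

end TangentPlane

section ImmersedSurface

/-! ### Maps into an immersed surface and locally constant functions -/

variable {M : Type*} [TopologicalSpace M] [ChartedSpace R2 M]

section Immersion

variable {κ τ : ℝ} {φ ξ : M → R3}

theorem IsOrientedSurface.mdifferentiableAt (hM : IsOrientedSurface κ τ φ ξ) (p : M) :
    MDifferentiableAt (𝓡 2) 𝓘(ℝ, R3) φ p :=
  (hM.smooth p).mdifferentiableAt (by simp)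

theorem IsOrientedSurface.mdifferentiableAt_normal (hM : IsOrientedSurface κ τ φ ξ) (p : M) :
    MDifferentiableAt (𝓡 2) 𝓘(ℝ, R3) ξ p :=
  (hM.smooth_normal p).mdifferentiableAt (by simp)

/-- `mfderiv` is the strict derivative of the expression in the preferred chart. -/
theorem hasStrictFDerivAt_chart {E : Type*} [NormedAddCommGroup E] [NormedSpace ℝ E] {h : M → E}
    {p : M} (hh : ContMDiffAt (𝓡 2) 𝓘(ℝ, E) ∞ h p) :
    HasStrictFDerivAt (h ∘ (extChartAt (𝓡 2) p).symm)
      (show R2 →L[ℝ] E from mfderiv (𝓡 2) 𝓘(ℝ, E) h p) (extChartAt (𝓡 2) p p) := by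
  have h1 := (contMDiffAt_iff.1 hh).2
  have h2 : ContDiffAt ℝ ∞ (h ∘ (extChartAt (𝓡 2) p).symm) (extChartAt (𝓡 2) p p) := by
    rw [ModelWithCorners.range_eq_univ, contDiffWithinAt_univ] at h1
    exact h1
  have h3 := h2.hasStrictFDerivAt (by simp)
  have h4 : mfderiv (𝓡 2) 𝓘(ℝ, E) h p
      = fderiv ℝ (h ∘ (extChartAt (𝓡 2) p).symm) (extChartAt (𝓡 2) p p) := by
    rw [(hh.mdifferentiableAt (by simp)).mfderiv, ModelWithCorners.range_eq_univ,
      fderivWithin_univ]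
    rfl
  rw [← h4] at h3
  exact h3

/-- An immersion has a local left inverse: the chart at `p` factors through `φ` near `p`. -/
theorem IsOrientedSurface.exists_leftInverse (hM : IsOrientedSurface κ τ φ ξ) (p : M) :
    ∃ ψ : R3 → R2, DifferentiableAt ℝ ψ (φ p) ∧
      ∀ᶠ m in nhds p, ψ (φ m) = extChartAt (𝓡 2) p m := by
  have h1 := hasStrictFDerivAt_chart (hM.smooth p)
  set D : R2 →L[ℝ] R3 := (show R2 →L[ℝ] R3 from mfderiv (𝓡 2) 𝓘(ℝ, R3) φ p) with hD
  have hinj : LinearMap.ker D.toLinearMap = ⊥ := LinearMap.ker_eq_bot.2 (hM.immersion p)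
  obtain ⟨P, hP⟩ := LinearMap.exists_leftInverse_of_injective D.toLinearMap hinj
  let P' : R3 →L[ℝ] R2 := LinearMap.toContinuousLinearMap P
  have h2 : HasStrictFDerivAt (P' ∘ (φ ∘ (extChartAt (𝓡 2) p).symm))
      ((ContinuousLinearEquiv.refl ℝ R2 : R2 ≃L[ℝ] R2) : R2 →L[ℝ] R2)
      (extChartAt (𝓡 2) p p) := by
    have h3 : P'.comp D = ((ContinuousLinearEquiv.refl ℝ R2 : R2 ≃L[ℝ] R2) : R2 →L[ℝ] R2) :=
      ContinuousLinearMap.ext fun v => LinearMap.congr_fun hP v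
    rw [← h3]
    exact P'.hasStrictFDerivAt.comp (extChartAt (𝓡 2) p p) h1
  have hp : (extChartAt (𝓡 2) p).symm (extChartAt (𝓡 2) p p) = p := extChartAt_to_inv p
  refine ⟨h2.localInverse ∘ P', ?_, ?_⟩
  · have h3 := h2.to_localInverse.hasFDerivAt.differentiableAt
    have h4 : (P' ∘ (φ ∘ (extChartAt (𝓡 2) p).symm)) (extChartAt (𝓡 2) p p) = P' (φ p) := by
      simp only [Function.comp_apply, hp]
    rw [h4] at h3
    exact h3.comp (φ p) P'.differentiableAt
  · have h3 := h2.eventually_left_inverse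
    have h4 := (continuousAt_extChartAt (I := 𝓡 2) p).eventually h3
    filter_upwards [h4, extChartAt_source_mem_nhds (I := 𝓡 2) p] with m hm hms
    simp only [Function.comp_apply, (extChartAt (𝓡 2) p).left_inv hms] at hm
    exact hm

/-- A continuous map into an immersed surface is differentiable as soon as it is so as a map
into the ambient space. -/
theorem IsOrientedSurface.mdifferentiableAt_of_comp [IsManifold (𝓡 2) ∞ M]
    (hM : IsOrientedSurface κ τ φ ξ)
    {E H N : Type*} [NormedAddCommGroup E] [NormedSpace ℝ E] [TopologicalSpace H]
    {I : ModelWithCorners ℝ E H} [TopologicalSpace N] [ChartedSpace H N] {g : N → M} {n : N}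
    (hg : ContinuousAt g n) (h : MDifferentiableAt I 𝓘(ℝ, R3) (φ ∘ g) n) :
    MDifferentiableAt I (𝓡 2) g n := by
  obtain ⟨ψ, hψ, h1⟩ := hM.exists_leftInverse (g n)
  rw [mdifferentiableAt_iff_target]
  refine ⟨hg, ?_⟩
  have h2 : MDifferentiableAt I 𝓘(ℝ, R2) (ψ ∘ (φ ∘ g)) n :=
    MDifferentiableAt.comp (I' := 𝓘(ℝ, R3)) n hψ.mdifferentiableAt h
  exact h2.congr_of_eventuallyEq ((hg.eventually h1).mono fun m hm => hm.symm)

/-- The velocity of a continuous curve in an immersed surface whose image in the ambient space is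
differentiable. -/
theorem IsOrientedSurface.exists_velocity [IsManifold (𝓡 2) ∞ M]
    (hM : IsOrientedSurface κ τ φ ξ) {c : ℝ → M} {p : M} {v : R3} (hc : ContinuousAt c 0)
    (hp : c 0 = p) (hv : HasDerivAt (φ ∘ c) v 0) :
    ∃ X : TangentSpace (𝓡 2) p, diff φ p X = v ∧
      ∀ h : M → ℝ, MDifferentiableAt (𝓡 2) 𝓘(ℝ, ℝ) h p →
        HasDerivAt (h ∘ c) (dirDeriv h p X) 0 := by
  subst hp
  have h1 : MDifferentiableAt 𝓘(ℝ, ℝ) (𝓡 2) c 0 :=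
    hM.mdifferentiableAt_of_comp hc hv.differentiableAt.mdifferentiableAt
  refine ⟨mfderiv 𝓘(ℝ, ℝ) (𝓡 2) c 0 (1 : ℝ), ?_, fun h hh => ?_⟩
  · have h2 := (hM.mdifferentiableAt (c 0)).hasMFDerivAt.comp 0 h1.hasMFDerivAt
    have h3 : HasFDerivAt (φ ∘ c) (show ℝ →L[ℝ] R3 from
        (diff φ (c 0)).comp (mfderiv 𝓘(ℝ, ℝ) (𝓡 2) c 0)) 0 := hasMFDerivAt_iff_hasFDerivAt.1 h2
    exact h3.hasDerivAt.unique hv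
  · have h2 := hh.hasMFDerivAt.comp 0 h1.hasMFDerivAt
    have h3 : HasFDerivAt (h ∘ c) (show ℝ →L[ℝ] ℝ from
        (mfderiv (𝓡 2) 𝓘(ℝ, ℝ) h (c 0)).comp (mfderiv 𝓘(ℝ, ℝ) (𝓡 2) c 0)) 0 :=
      hasMFDerivAt_iff_hasFDerivAt.1 h2
    exact h3.hasDerivAt

/-- A continuous curve in an immersed surface with constant image in the ambient space is
constant. -/
theorem IsOrientedSurface.eq_of_comp_eq (hM : IsOrientedSurface κ τ φ ξ) {c : ℝ → M}
    (hc : Continuous c) (h : ∀ s t, φ (c s) = φ (c t)) (s t : ℝ) : c s = c t := by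
  have h1 : IsLocallyConstant c := by
    rw [IsLocallyConstant.iff_eventually_eq]
    intro t
    obtain ⟨ψ, -, h1⟩ := hM.exists_leftInverse (c t)
    have h2 := h1.self_of_nhds
    filter_upwards [hc.continuousAt.eventually h1,
      hc.continuousAt.eventually (extChartAt_source_mem_nhds (I := 𝓡 2) (c t))] with s hs hs'
    refine (extChartAt (𝓡 2) (c t)).injOn hs' (mem_extChartAt_source (c t)) ?_
    rw [← hs, ← h2, h s t]
  exact h1.apply_eq_of_preconnectedSpace s t

end Immersion

theorem eq_of_mfderiv_eq_zero [IsManifold (𝓡 2) ∞ M] [ConnectedSpace M] {h : M → ℝ}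
    (hd : ∀ p, HasMFDerivAt (𝓡 2) 𝓘(ℝ, ℝ) h p 0) (p q : M) : h p = h q := by
  have h1 : IsLocallyConstant h := by
    rw [IsLocallyConstant.iff_eventually_eq]
    intro p
    have ht := extChartAt_target_mem_nhds (I := 𝓡 2) p
    obtain ⟨r, hr, hball⟩ := Metric.mem_nhds_iff.1 ht
    have hfd : ∀ y ∈ Metric.ball (extChartAt (𝓡 2) p p) r,
        HasFDerivAt (h ∘ (extChartAt (𝓡 2) p).symm) (0 : R2 →L[ℝ] ℝ) y := by
      intro y hy
      have h2 := (mdifferentiableOn_extChartAt_symm (I := 𝓡 2) (x := p) y (hball hy)).mdifferentiableAt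
        ((isOpen_extChartAt_target (I := 𝓡 2) p).mem_nhds (hball hy))
      have h3 := (hd _).comp y h2.hasMFDerivAt
      have h4 : HasFDerivAt (h ∘ (extChartAt (𝓡 2) p).symm) (show R2 →L[ℝ] ℝ from
          (0 : TangentSpace (𝓡 2) ((extChartAt (𝓡 2) p).symm y) →L[ℝ] ℝ).comp
            (mfderiv 𝓘(ℝ, R2) (𝓡 2) (extChartAt (𝓡 2) p).symm y)) y :=
        hasMFDerivAt_iff_hasFDerivAt.1 h3
      refine h4.congr_fderiv ?_
      ext1 v
      rfl
    filter_upwards [(continuousAt_extChartAt (I := 𝓡 2) p).eventually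
      (Metric.ball_mem_nhds _ hr), extChartAt_source_mem_nhds (I := 𝓡 2) p] with m hm hms
    have h5 := (convex_ball _ r).is_const_of_fderivWithin_eq_zero (𝕜 := ℝ)
      (f := h ∘ (extChartAt (𝓡 2) p).symm)
      (fun y hy => (hfd y hy).differentiableAt.differentiableWithinAt)
      (fun y hy => by
        rw [fderivWithin_of_isOpen Metric.isOpen_ball hy]
        exact (hfd y hy).fderiv) hm (Metric.mem_ball_self hr)
    simpa only [Function.comp_apply, (extChartAt (𝓡 2) p).left_inv hms, extChartAt_to_inv] using h5
  exact h1.apply_eq_of_preconnectedSpace p q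

/-! ### Rotations -/

/-- The rotation by the angle `t`, as a continuous linear map. -/
def rotationCLM (t : ℝ) : R3 →L[ℝ] R3 :=
  LinearMap.toContinuousLinearMap
    { toFun := rotation t
      map_add' := fun v w => by
        funext i
        fin_cases i <;> simp [rotation] <;> ring
      map_smul' := fun a v => by
        funext i
        fin_cases i <;> simp [rotation] <;> ring }

theorem rotation_neg_rotation (t : ℝ) (v : R3) : rotation t (rotation (-t) v) = v := by
  have h := Real.sin_sq_add_cos_sq t
  funext i
  fin_cases i
  · simp [rotation]
    linear_combination v 0 * h
  · simp [rotation]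
    linear_combination v 1 * h
  · simp [rotation]

theorem rotation_apply_zero (t : ℝ) (v : R3) :
    rotation t v 0 = Real.cos t * v 0 - Real.sin t * v 1 := rfl

theorem rotation_apply_one (t : ℝ) (v : R3) :
    rotation t v 1 = Real.sin t * v 0 + Real.cos t * v 1 := rfl

theorem rotation_apply_two (t : ℝ) (v : R3) : rotation t v 2 = v 2 := rfl

theorem rotation_dot (t : ℝ) (v w : R3) :
    rotation t v 0 * rotation t w 0 + rotation t v 1 * rotation t w 1
      = v 0 * w 0 + v 1 * w 1 := by
  rw [rotation_apply_zero, rotation_apply_zero, rotation_apply_one, rotation_apply_one]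
  linear_combination (v 0 * w 0 + v 1 * w 1) * Real.sin_sq_add_cos_sq t

theorem rotation_wedge (t : ℝ) (v w : R3) :
    rotation t v 1 * rotation t w 0 - rotation t v 0 * rotation t w 1
      = v 1 * w 0 - v 0 * w 1 := by
  rw [rotation_apply_zero, rotation_apply_zero, rotation_apply_one, rotation_apply_one]
  linear_combination (v 1 * w 0 - v 0 * w 1) * Real.sin_sq_add_cos_sq t

theorem rotation_sq (t : ℝ) (v : R3) :
    rotation t v 0 ^ 2 + rotation t v 1 ^ 2 = v 0 ^ 2 + v 1 ^ 2 := by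
  have h := rotation_dot t v v
  nlinarith

theorem conf_rotation (κ t : ℝ) (p : R3) : conf κ (rotation t p) = conf κ p := by
  rw [conf, rotation_sq, conf]

theorem contactForm_rotation (κ τ t : ℝ) (p v : R3) :
    contactForm κ τ (rotation t p) (rotation t v) = contactForm κ τ p v := by
  rw [contactForm, contactForm, rotation_wedge, conf_rotation, rotation_apply_two]

theorem metric_rotation (κ τ t : ℝ) (p v w : R3) :
    metric κ τ (rotation t p) (rotation t v) (rotation t w) = metric κ τ p v w := by
  simp only [metric, rotation_dot, conf_rotation, contactForm_rotation]

/-- The value at `p` of the Killing field `x ∂_y - y ∂_x` of the rotations. -/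
def rotationField (p : R3) : R3 := ![-p 1, p 0, 0]

theorem hasDerivAt_rotation (p : R3) :
    HasDerivAt (fun t => rotation t p) (rotationField p) 0 := by
  rw [hasDerivAt_pi]
  intro i
  fin_cases i
  · have h := ((Real.hasDerivAt_cos 0).mul_const (p 0)).fun_sub ((Real.hasDerivAt_sin 0).mul_const (p 1))
    simpa [rotationField, rotation] using h
  · have h := ((Real.hasDerivAt_sin 0).mul_const (p 0)).fun_add ((Real.hasDerivAt_cos 0).mul_const (p 1))
    simpa [rotationField, rotation] using h
  · simpa [rotationField, rotation] using hasDerivAt_const (0 : ℝ) (p 2)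

theorem continuous_rotation {X : Type*} [TopologicalSpace X] {f : X → ℝ} {u : X → R3}
    (hf : Continuous f) (hu : Continuous u) : Continuous fun x => rotation (f x) (u x) := by
  have h0 : Continuous fun x => u x 0 := (continuous_apply 0).comp hu
  have h1 : Continuous fun x => u x 1 := (continuous_apply 1).comp hu
  have h2 : Continuous fun x => u x 2 := (continuous_apply 2).comp hu
  refine continuous_pi fun i => ?_
  fin_cases i
  · exact ((Real.continuous_cos.comp hf).mul h0).sub ((Real.continuous_sin.comp hf).mul h1)
  · exact ((Real.continuous_sin.comp hf).mul h0).add ((Real.continuous_cos.comp hf).mul h1)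
  · exact h2

section Revolution

variable {κ τ : ℝ} {φ ξ : M → R3} {ρ : Flow ℝ M}

theorem IsOrientedSurface.mdifferentiableAt_flow [IsManifold (𝓡 2) ∞ M]
    (hM : IsOrientedSurface κ τ φ ξ) (hρ : ∀ t p, φ (ρ t p) = rotation t (φ p)) (t : ℝ) (p : M) :
    MDifferentiableAt (𝓡 2) (𝓡 2) (ρ t) p := by
  refine hM.mdifferentiableAt_of_comp (ρ.continuous_toFun t).continuousAt ?_
  have h : φ ∘ ρ t = rotationCLM t ∘ φ := funext fun p => hρ t p
  rw [h]
  exact MDifferentiableAt.comp (I' := 𝓘(ℝ, R3)) p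
    (rotationCLM t).differentiableAt.mdifferentiableAt (hM.mdifferentiableAt p)

theorem IsOrientedSurface.diff_flow [IsManifold (𝓡 2) ∞ M]
    (hM : IsOrientedSurface κ τ φ ξ) (hρ : ∀ t p, φ (ρ t p) = rotation t (φ p)) (t : ℝ) (p : M)
    (X : TangentSpace (𝓡 2) p) :
    diff φ (ρ t p) (mfderiv (𝓡 2) (𝓡 2) (ρ t) p X) = rotation t (diff φ p X) := by
  have h : φ ∘ ρ t = rotationCLM t ∘ φ := funext fun p => hρ t p
  have h1 := (hM.mdifferentiableAt (ρ t p)).hasMFDerivAt.comp p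
    (hM.mdifferentiableAt_flow hρ t p).hasMFDerivAt
  have h2 := ((rotationCLM t).hasFDerivAt (x := φ p)).hasMFDerivAt.comp p
    (hM.mdifferentiableAt p).hasMFDerivAt
  rw [h] at h1
  have h3 := hasMFDerivAt_unique h1 h2
  exact DFunLike.congr_fun h3 X

/-- A unit normal vector is determined up to sign. -/
theorem IsOrientedSurface.eq_smul_normal (hM : IsOrientedSurface κ τ φ ξ) {p : M} {w : R3}
    (hw : ∀ X, metric κ τ (φ p) w (diff φ p X) = 0) :
    w = metric κ τ (φ p) w (ξ p) • ξ p := by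
  set s := metric κ τ (φ p) w (ξ p) with hs
  have h1 : metric κ τ (φ p) (ξ p) (w + (-s) • ξ p) = 0 := by
    rw [metric_add_right, metric_smul_right, hM.unit_normal, metric_comm, ← hs]
    ring
  obtain ⟨X, hX⟩ := hM.exists_diff_eq p h1
  have h2 : metric κ τ (φ p) (w + (-s) • ξ p) (w + (-s) • ξ p) = 0 := by
    have h3 : metric κ τ (φ p) (w + (-s) • ξ p) (diff φ p X) = 0 := by
      rw [metric_add_left, hw, metric_smul_left, hM.normal]
      ring
    rwa [hX] at h3
  have h3 := eq_zero_of_metric_self κ τ (hM.mem_space p) h2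
  rw [neg_smul, ← sub_eq_add_neg, sub_eq_zero] at h3
  exact h3

/-- The unit normal of a surface of revolution is equivariant: a unit normal vector is unique up to
sign, and the sign is continuous in the angle of rotation. -/
theorem IsOrientedSurface.normal_flow [IsManifold (𝓡 2) ∞ M]
    (hM : IsOrientedSurface κ τ φ ξ) (hρ : ∀ t p, φ (ρ t p) = rotation t (φ p)) (t : ℝ) (p : M) :
    ξ (ρ t p) = rotation t (ξ p) := by
  let w : ℝ → R3 := fun t => rotation (-t) (ξ (ρ t p))
  let s : ℝ → ℝ := fun t => metric κ τ (φ p) (w t) (ξ p)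
  have hrot : ∀ t, rotation t (w t) = ξ (ρ t p) := fun t => rotation_neg_rotation t _
  have hw : ∀ t, w t = s t • ξ p := by
    intro t
    refine hM.eq_smul_normal fun X => ?_
    rw [← metric_rotation κ τ t, hrot, ← hρ, ← hM.diff_flow hρ]
    exact hM.normal _ _
  have hsq : ∀ t, s t ^ 2 = 1 := by
    intro t
    have h1 := hM.unit_normal (ρ t p)
    rw [← hrot, hρ, metric_rotation, hw, metric_smul_left, metric_smul_right, hM.unit_normal] at h1
    linarith
  have hξc : Continuous fun t : ℝ => ξ (ρ t p) :=
    hM.smooth_normal.continuous.comp (ρ.continuous continuous_id continuous_const)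
  have hwc : Continuous w := continuous_rotation continuous_neg hξc
  have hsc : Continuous s := by
    have h0 := (continuous_apply (0 : Fin 3)).comp hwc
    have h1 := (continuous_apply (1 : Fin 3)).comp hwc
    have h2 := (continuous_apply (2 : Fin 3)).comp hwc
    simp only [Function.comp_def] at h0 h1 h2
    simp only [s, metric, contactForm]
    fun_prop
  have h0 : s 0 = 1 := by
    have h1 : w 0 = ξ p := by
      funext i
      fin_cases i <;> simp [w, rotation]
    change metric κ τ (φ p) (w 0) (ξ p) = 1
    rw [h1, hM.unit_normal]
  have h1 : s t = 1 := by
    rcases isPreconnected_univ.eq_one_or_eq_neg_one_of_sq_eq hsc.continuousOn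
      (fun t _ => hsq t) with h | h
    · exact h (Set.mem_univ t)
    · have := h (Set.mem_univ 0)
      simp [h0] at this
      norm_num at this
  rw [← hrot, hw, h1, one_smul]

end Revolution

end ImmersedSurface

/-! ### The frame of parallels and meridians -/

/-- The squared distance `x² + y²` to the axis of revolution. -/
def radiusSq (q : R3) : ℝ := q 0 ^ 2 + q 1 ^ 2

/-- The vector with coordinates `F (μ x - τ c y)`, `F (μ y + τ c x)`, `c (1 + τ² (x² + y²))`. It is
orthogonal to the rotation field, and `c` is its component along the Hopf field. -/
def normalVec (κ τ : ℝ) (q : R3) (μ c : ℝ) : R3 :=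
  ![conf κ q * (μ * q 0 - τ * c * q 1), conf κ q * (μ * q 1 + τ * c * q 0),
    c * (1 + τ ^ 2 * radiusSq q)]

/-- A vector orthogonal to both the rotation field and `normalVec κ τ q μ c`. It is scaled so as to
be polynomial in `μ`, `c` and the coordinates; its squared length is `s (1 + τ² s)`,
`s = x² + y²`, when `normalVec κ τ q μ c` is a unit vector. -/
def meridianVec (κ τ : ℝ) (q : R3) (μ c : ℝ) : R3 :=
  ![conf κ q * ((1 + τ ^ 2 * radiusSq q) * c * q 0 + τ * radiusSq q * μ * q 1),
    conf κ q * ((1 + τ ^ 2 * radiusSq q) * c * q 1 - τ * radiusSq q * μ * q 0),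
    -(radiusSq q * μ * (1 + τ ^ 2 * radiusSq q))]

/-- The derivative of `normalVec` along a curve with velocity `v`, when `μ` and `c` have the
derivatives `μ'` and `c'`. -/
def normalVecDeriv (κ τ : ℝ) (q v : R3) (μ c μ' c' : ℝ) : R3 :=
  ![κ / 2 * (q 0 * v 0 + q 1 * v 1) * (μ * q 0 - τ * c * q 1)
      + conf κ q * (μ' * q 0 + μ * v 0 - τ * c' * q 1 - τ * c * v 1),
    κ / 2 * (q 0 * v 0 + q 1 * v 1) * (μ * q 1 + τ * c * q 0)
      + conf κ q * (μ' * q 1 + μ * v 1 + τ * c' * q 0 + τ * c * v 0),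
    c' * (1 + τ ^ 2 * radiusSq q) + c * (τ ^ 2 * (2 * (q 0 * v 0 + q 1 * v 1)))]

/-- `-g(n' + Γ(v, n), w)`: the second fundamental form in terms of the derivative `n'` of the
normal `n` in the direction `v`. -/
def secondForm (κ τ : ℝ) (q v n n' w : R3) : ℝ :=
  -(metric κ τ q n' w + 1 / 2 * (metricDeriv κ τ q v n w + metricDeriv κ τ q n v w
          - metricDeriv κ τ q w v n))

theorem metric_rotationField {κ τ : ℝ} {q : R3} (hq : q ∈ space κ) :
    metric κ τ q (rotationField q) (rotationField q)
      = radiusSq q * (1 + τ ^ 2 * radiusSq q) / conf κ q ^ 2 := by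
  have hF : conf κ q ≠ 0 := ne_of_gt hq
  simp [metric, contactForm, rotationField, radiusSq]
  field_simp
  ring

theorem metric_meridianVec {κ τ : ℝ} {q : R3} (hq : q ∈ space κ)
    (μ c : ℝ) :
    metric κ τ q (meridianVec κ τ q μ c) (meridianVec κ τ q μ c)
      = radiusSq q * (1 + τ ^ 2 * radiusSq q)
        * (radiusSq q * μ ^ 2 + c ^ 2 * (1 + τ ^ 2 * radiusSq q)) := by
  have hF : conf κ q ≠ 0 := ne_of_gt hq
  simp [metric, contactForm, meridianVec, radiusSq]
  field_simp
  ring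

theorem metric_rotationField_meridianVec {κ τ : ℝ} {q : R3} (hq : q ∈ space κ)
    (μ c : ℝ) :
    metric κ τ q (rotationField q) (meridianVec κ τ q μ c) = 0 := by
  have hF : conf κ q ≠ 0 := ne_of_gt hq
  simp [metric, contactForm, meridianVec, rotationField, radiusSq]
  field_simp
  ring

theorem metric_normalVec_meridianVec {κ τ : ℝ} {q : R3} (hq : q ∈ space κ)
    (μ c : ℝ) :
    metric κ τ q (normalVec κ τ q μ c) (meridianVec κ τ q μ c) = 0 := by
  have hF : conf κ q ≠ 0 := ne_of_gt hq
  simp [metric, contactForm, meridianVec, normalVec, radiusSq]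
  field_simp
  ring

theorem contactForm_meridianVec {κ τ : ℝ} {q : R3} (hq : q ∈ space κ)
    (μ c : ℝ) :
    contactForm κ τ q (meridianVec κ τ q μ c) = -(radiusSq q * μ) := by
  have hF : conf κ q ≠ 0 := ne_of_gt hq
  simp [contactForm, meridianVec, radiusSq]
  field_simp
  ring

theorem contactForm_rotationField (κ τ : ℝ) (q : R3) :
    contactForm κ τ q (rotationField q) = -(τ * radiusSq q / conf κ q) := by
  simp [contactForm, rotationField, radiusSq]
  ring

theorem secondForm_rotationField {κ τ : ℝ} {q : R3} (hq : q ∈ space κ)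
    (μ c : ℝ) :
    secondForm κ τ q (rotationField q) (normalVec κ τ q μ c)
      (normalVecDeriv κ τ q (rotationField q) μ c 0 0) (rotationField q)
      = -(radiusSq q * μ / conf κ q ^ 2)
        * ((1 + τ ^ 2 * radiusSq q) * (1 - κ / 4 * radiusSq q)
          + τ ^ 2 * radiusSq q * conf κ q) := by
  have hF : conf κ q ≠ 0 := ne_of_gt hq
  have hF' : conf κ q = 1 + κ / 4 * (q 0 ^ 2 + q 1 ^ 2) := rfl
  simp [secondForm, metric, metricDeriv, contactForm, normalVec, normalVecDeriv, rotationField,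
    radiusSq]
  field_simp
  simp only [hF']
  ring

theorem secondForm_meridian_parallel {κ τ : ℝ} {q : R3} (hq : q ∈ space κ)
    (μ c μ' c' : ℝ) :
    secondForm κ τ q (meridianVec κ τ q μ c) (normalVec κ τ q μ c)
      (normalVecDeriv κ τ q (meridianVec κ τ q μ c) μ c μ' c') (rotationField q)
      = τ * (4 * τ ^ 2 - κ) * radiusSq q ^ 2 / (4 * conf κ q)
        * (radiusSq q * μ ^ 2 + c ^ 2 * (1 + τ ^ 2 * radiusSq q)) := by
  have hF : conf κ q ≠ 0 := ne_of_gt hq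
  have hF' : conf κ q = 1 + κ / 4 * (q 0 ^ 2 + q 1 ^ 2) := rfl
  simp [secondForm, metric, metricDeriv, contactForm, normalVec, normalVecDeriv, meridianVec,
    rotationField, radiusSq]
  field_simp
  simp only [hF']
  ring

theorem secondForm_meridian {κ τ : ℝ} {q : R3} (hq : q ∈ space κ)
    (μ c μ' c' : ℝ) :
    secondForm κ τ q (meridianVec κ τ q μ c) (normalVec κ τ q μ c)
      (normalVecDeriv κ τ q (meridianVec κ τ q μ c) μ c μ' c') (meridianVec κ τ q μ c)
      = radiusSq q * ((1 + τ ^ 2 * radiusSq q) * (μ * c' - c * μ' - μ * conf κ q * c ^ 2)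
        + radiusSq q * μ * conf κ q * τ ^ 2
          * (radiusSq q * μ ^ 2 + c ^ 2 * (1 + τ ^ 2 * radiusSq q))) := by
  have hF : conf κ q ≠ 0 := ne_of_gt hq
  have hF' : conf κ q = 1 + κ / 4 * (q 0 ^ 2 + q 1 ^ 2) := rfl
  simp [secondForm, metric, metricDeriv, contactForm, normalVec, normalVecDeriv, meridianVec,
    radiusSq]
  field_simp
  simp only [hF']
  ring

/-- A vector orthogonal to the rotation field is a `normalVec`. -/
theorem eq_normalVec {κ τ : ℝ} {q n : R3} (hq : q ∈ space κ) (hr : radiusSq q ≠ 0)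
    (h : metric κ τ q n (rotationField q) = 0) :
    n = normalVec κ τ q ((q 0 * n 0 + q 1 * n 1) / (radiusSq q * conf κ q))
      (contactForm κ τ q n) := by
  have hF : conf κ q ≠ 0 := ne_of_gt hq
  have h1 : n 1 * q 0 - n 0 * q 1 = τ * radiusSq q * conf κ q * contactForm κ τ q n := by
    have h2 : contactForm κ τ q (rotationField q) = -(τ * radiusSq q / conf κ q) :=
      contactForm_rotationField κ τ q
    rw [metric, h2] at h
    simp [rotationField] at h
    field_simp at h
    linear_combination h
  have h2 : n 2 = contactForm κ τ q n * (1 + τ ^ 2 * radiusSq q) := by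
    have h3 : contactForm κ τ q n = n 2 - τ * (n 1 * q 0 - n 0 * q 1) / conf κ q := by
      simp only [contactForm]
      ring
    rw [h1] at h3
    field_simp at h3
    linear_combination -h3
  funext i
  fin_cases i
  · simp [normalVec]
    field_simp
    simp only [radiusSq] at h1 ⊢
    linear_combination (-q 1) * h1
  · simp [normalVec]
    field_simp
    simp only [radiusSq] at h1 ⊢
    linear_combination (q 0) * h1
  · simpa [normalVec] using h2

theorem metric_normalVec {κ τ : ℝ} {q : R3} (hq : q ∈ space κ) (μ c : ℝ) :
    metric κ τ q (normalVec κ τ q μ c) (normalVec κ τ q μ c)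
      = radiusSq q * μ ^ 2 + c ^ 2 * (1 + τ ^ 2 * radiusSq q) := by
  have hF : conf κ q ≠ 0 := ne_of_gt hq
  simp [metric, contactForm, normalVec, radiusSq]
  field_simp
  ring

section SurfaceOfRevolution

/-! ### Surfaces of revolution -/

/-- The component of `ξ` along the horizontal radial direction, in units in which the unit normal of
a cylinder of radius `r` has the component `± 1 / r`. -/
def radialPart {M : Type*} (κ : ℝ) (φ ξ : M → R3) (p : M) : ℝ :=
  (φ p 0 * ξ p 0 + φ p 1 * ξ p 1) / (radiusSq (φ p) * conf κ (φ p))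

/-- The component `g(ξ, E₃)` of `ξ` along the Hopf field, that is, `cos α`. -/
def hopfPart {M : Type*} (κ τ : ℝ) (φ ξ : M → R3) (p : M) : ℝ :=
  contactForm κ τ (φ p) (ξ p)

theorem angle_eq_arccos_hopfPart {M : Type*} (κ τ : ℝ) (φ ξ : M → R3) (p : M) :
    angle κ τ φ ξ p = Real.arccos (hopfPart κ τ φ ξ p) := by
  rw [angle, hopfPart]
  congr 1
  simp [metric, contactForm, coordVec]

variable {M : Type*} [TopologicalSpace M] [ChartedSpace R2 M]

/-- The curve through `p` which is the straight line in the direction `X` in the chart at `p`. -/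
def chartLine (p : M) (X : TangentSpace (𝓡 2) p) (t : ℝ) : M :=
  (extChartAt (𝓡 2) p).symm (extChartAt (𝓡 2) p p + t • (show R2 from X))

theorem chartLine_zero (p : M) (X : TangentSpace (𝓡 2) p) : chartLine p X 0 = p := by
  rw [chartLine, zero_smul, add_zero, extChartAt_to_inv]

theorem hasDerivAt_chartLine {E : Type*} [NormedAddCommGroup E] [NormedSpace ℝ E] {h : M → E}
    {p : M} (hh : MDifferentiableAt (𝓡 2) 𝓘(ℝ, E) h p) (X : TangentSpace (𝓡 2) p) :
    HasDerivAt (fun t => h (chartLine p X t)) (show E from mfderiv (𝓡 2) 𝓘(ℝ, E) h p X) 0 := by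
  have h1 : HasFDerivWithinAt (h ∘ (extChartAt (𝓡 2) p).symm)
      (show R2 →L[ℝ] E from mfderiv (𝓡 2) 𝓘(ℝ, E) h p) (Set.range (𝓡 2))
      (extChartAt (𝓡 2) p p) := hh.hasMFDerivAt.2
  rw [ModelWithCorners.range_eq_univ, hasFDerivWithinAt_univ] at h1
  have h2 : HasFDerivAt (h ∘ (extChartAt (𝓡 2) p).symm)
      (show R2 →L[ℝ] E from mfderiv (𝓡 2) 𝓘(ℝ, E) h p)
      (extChartAt (𝓡 2) p p + (0 : ℝ) • (show R2 from X)) := by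
    rw [zero_smul, add_zero]
    exact h1
  have h3 : ∀ v w : R2, HasDerivAt (fun t : ℝ => v + t • w) w 0 := fun v w =>
    (((hasDerivAt_id (0 : ℝ)).smul_const w).const_add v).congr_deriv (one_smul ℝ w)
  exact h2.comp_hasDerivAt (0 : ℝ) (h3 _ _)

variable {κ τ : ℝ} {φ ξ : M → R3} {ρ : Flow ℝ M}

theorem rotation_pi (v : R3) : rotation Real.pi v = ![-v 0, -v 1, v 2] := by
  simp [rotation]

/-- A surface of revolution which is nowhere horizontal does not meet the axis: a point on the axis
would be a fixed point of the flow, and its normal vector would be vertical. -/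
theorem IsOrientedSurface.radiusSq_pos [IsManifold (𝓡 2) ∞ M] (hM : IsOrientedSurface κ τ φ ξ)
    (hρ : ∀ t p, φ (ρ t p) = rotation t (φ p))
    (hα : ∀ p, angle κ τ φ ξ p ∈ Set.Ioo 0 Real.pi) (p : M) : 0 < radiusSq (φ p) := by
  have hnn : 0 ≤ radiusSq (φ p) := add_nonneg (sq_nonneg _) (sq_nonneg _)
  refine lt_of_le_of_ne hnn fun h0 => ?_
  have hx : φ p 0 = 0 := by
    unfold radiusSq at h0
    nlinarith [sq_nonneg (φ p 0), sq_nonneg (φ p 1)]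
  have hy : φ p 1 = 0 := by
    unfold radiusSq at h0
    nlinarith [sq_nonneg (φ p 0), sq_nonneg (φ p 1)]
  have h1 : ∀ t, φ (ρ t p) = φ p := by
    intro t
    rw [hρ]
    funext i
    fin_cases i <;> simp [rotation, hx, hy]
  have h2 : ρ Real.pi p = p := by
    have h := hM.eq_of_comp_eq (c := fun t => ρ t p)
      (ρ.continuous continuous_id continuous_const) (fun s t => by rw [h1, h1]) Real.pi 0
    simpa using h
  -- The half turn fixes `p`, hence `ξ p`, but it reverses horizontal vectors.
  have h3 := hM.normal_flow hρ Real.pi p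
  rw [h2, rotation_pi] at h3
  have hξ0 : ξ p 0 = 0 := by
    have h := congrFun h3 0
    simp at h
    linarith
  have hξ1 : ξ p 1 = 0 := by
    have h := congrFun h3 1
    simp at h
    linarith
  have h4 := hM.unit_normal p
  have h5 : (hopfPart κ τ φ ξ p - 1) * (hopfPart κ τ φ ξ p + 1) = 0 := by
    simp only [metric, hξ0, hξ1] at h4
    simp only [hopfPart]
    linear_combination h4
  have h6 := hα p
  rw [angle_eq_arccos_hopfPart] at h6
  rcases mul_eq_zero.1 h5 with h | h
  · rw [sub_eq_zero.1 h, Real.arccos_one] at h6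
    exact lt_irrefl _ h6.1
  · rw [eq_neg_of_add_eq_zero_left h, Real.arccos_neg_one] at h6
    exact lt_irrefl _ h6.2

/-- The tangent vector of the parallel through `p`: `φ` maps it to the rotation field, and invariant
functions have derivative `0` along it. -/
theorem IsOrientedSurface.exists_parallel [IsManifold (𝓡 2) ∞ M] (hM : IsOrientedSurface κ τ φ ξ)
    (hρ : ∀ t p, φ (ρ t p) = rotation t (φ p)) (p : M) :
    ∃ X : TangentSpace (𝓡 2) p, diff φ p X = rotationField (φ p) ∧
      ∀ h : M → ℝ, (∀ t, h (ρ t p) = h p) → dirDeriv h p X = 0 := by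
  have h1 : HasDerivAt (φ ∘ fun t => ρ t p) (rotationField (φ p)) 0 := by
    have h2 : (φ ∘ fun t => ρ t p) = fun t => rotation t (φ p) := funext fun t => hρ t p
    rw [h2]
    exact hasDerivAt_rotation (φ p)
  have hc : Continuous fun t => ρ t p := ρ.continuous continuous_id continuous_const
  obtain ⟨X, hX, hder⟩ := hM.exists_velocity hc.continuousAt (ρ.map_zero_apply p) h1
  refine ⟨X, hX, fun h hinv => ?_⟩
  by_cases hd : MDifferentiableAt (𝓡 2) 𝓘(ℝ, ℝ) h p
  · have h3 := hder h hd
    have h4 : (h ∘ fun t => ρ t p) = fun _ => h p := funext hinv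
    rw [h4] at h3
    exact h3.unique (hasDerivAt_const _ _)
  -- Where `h` is not differentiable, `mfderiv` takes the value `0`.
  · rw [dirDeriv, mfderiv_zero_of_not_mdifferentiableAt hd]
    rfl

theorem IsOrientedSurface.normal_eq [IsManifold (𝓡 2) ∞ M] (hM : IsOrientedSurface κ τ φ ξ)
    (hρ : ∀ t p, φ (ρ t p) = rotation t (φ p)) {p : M} (hr : 0 < radiusSq (φ p)) :
    ξ p = normalVec κ τ (φ p) (radialPart κ φ ξ p) (hopfPart κ τ φ ξ p) := by
  obtain ⟨X, hX, -⟩ := hM.exists_parallel hρ p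
  refine eq_normalVec (hM.mem_space p) hr.ne' ?_
  rw [← hX]
  exact hM.normal p X

theorem IsOrientedSurface.unit_eq [IsManifold (𝓡 2) ∞ M] (hM : IsOrientedSurface κ τ φ ξ)
    (hρ : ∀ t p, φ (ρ t p) = rotation t (φ p)) {p : M} (hr : 0 < radiusSq (φ p)) :
    radiusSq (φ p) * radialPart κ φ ξ p ^ 2
      + hopfPart κ τ φ ξ p ^ 2 * (1 + τ ^ 2 * radiusSq (φ p)) = 1 := by
  rw [← metric_normalVec (hM.mem_space p), ← hM.normal_eq hρ hr, hM.unit_normal]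

theorem IsOrientedSurface.radialPart_flow [IsManifold (𝓡 2) ∞ M] (hM : IsOrientedSurface κ τ φ ξ)
    (hρ : ∀ t p, φ (ρ t p) = rotation t (φ p)) (t : ℝ) (p : M) :
    radialPart κ φ ξ (ρ t p) = radialPart κ φ ξ p := by
  rw [radialPart, hM.normal_flow hρ, hρ, rotation_dot, conf_rotation, radiusSq, rotation_sq]
  rfl

theorem IsOrientedSurface.hopfPart_flow [IsManifold (𝓡 2) ∞ M] (hM : IsOrientedSurface κ τ φ ξ)
    (hρ : ∀ t p, φ (ρ t p) = rotation t (φ p)) (t : ℝ) (p : M) :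
    hopfPart κ τ φ ξ (ρ t p) = hopfPart κ τ φ ξ p := by
  rw [hopfPart, hM.normal_flow hρ, hρ, contactForm_rotation, hopfPart]

theorem IsOrientedSurface.mdifferentiableAt_radialPart (hM : IsOrientedSurface κ τ φ ξ) {p : M}
    (hr : 0 < radiusSq (φ p)) : MDifferentiableAt (𝓡 2) 𝓘(ℝ, ℝ) (radialPart κ φ ξ) p := by
  let G : R3 × R3 → ℝ := fun q =>
    (q.1 0 * q.2 0 + q.1 1 * q.2 1) / (radiusSq q.1 * conf κ q.1)
  have hF : conf κ (φ p) ≠ 0 := ne_of_gt (hM.mem_space p)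
  have hG : DifferentiableAt ℝ G (φ p, ξ p) := by
    have h0 : radiusSq (φ p) * conf κ (φ p) ≠ 0 := mul_ne_zero hr.ne' hF
    simp only [G, radiusSq, conf] at h0 ⊢
    fun_prop (disch := assumption)
  exact MDifferentiableAt.comp (I' := 𝓘(ℝ, R3 × R3)) p hG.mdifferentiableAt
    ((hM.mdifferentiableAt p).prodMk_space (hM.mdifferentiableAt_normal p))

theorem IsOrientedSurface.mdifferentiableAt_hopfPart (hM : IsOrientedSurface κ τ φ ξ) (p : M) :
    MDifferentiableAt (𝓡 2) 𝓘(ℝ, ℝ) (hopfPart κ τ φ ξ) p := by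
  let G : R3 × R3 → ℝ := fun q => contactForm κ τ q.1 q.2
  have hF : conf κ (φ p) ≠ 0 := ne_of_gt (hM.mem_space p)
  have hG : DifferentiableAt ℝ G (φ p, ξ p) := by
    simp only [G, contactForm, conf] at hF ⊢
    fun_prop (disch := assumption)
  exact MDifferentiableAt.comp (I' := 𝓘(ℝ, R3 × R3)) p hG.mdifferentiableAt
    ((hM.mdifferentiableAt p).prodMk_space (hM.mdifferentiableAt_normal p))

end SurfaceOfRevolution

section NormalDerivative

/-! ### The mean curvature of a surface of revolution -/

variable {M : Type*} [TopologicalSpace M] [ChartedSpace R2 M]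
variable {κ τ : ℝ} {φ ξ : M → R3} {ρ : Flow ℝ M}

theorem IsOrientedSurface.hasDerivAt_coord (hM : IsOrientedSurface κ τ φ ξ) {p : M}
    (X : TangentSpace (𝓡 2) p) (i : Fin 3) :
    HasDerivAt (fun t => φ (chartLine p X t) i) (diff φ p X i) 0 :=
  hasDerivAt_pi.1 (hasDerivAt_chartLine (hM.mdifferentiableAt p) X) i

theorem IsOrientedSurface.hasDerivAt_radiusSq (hM : IsOrientedSurface κ τ φ ξ) {p : M}
    (X : TangentSpace (𝓡 2) p) :
    HasDerivAt (fun t => radiusSq (φ (chartLine p X t)))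
      (2 * (φ p 0 * diff φ p X 0 + φ p 1 * diff φ p X 1)) 0 := by
  have h := ((hM.hasDerivAt_coord X 0).fun_pow 2).fun_add ((hM.hasDerivAt_coord X 1).fun_pow 2)
  rw [chartLine_zero] at h
  refine h.congr_deriv ?_
  norm_num
  ring

theorem IsOrientedSurface.metric_covDeriv_eq (hM : IsOrientedSurface κ τ φ ξ) (p : M)
    (X : TangentSpace (𝓡 2) p) (w : R3) :
    -metric κ τ (φ p) (covDeriv κ τ φ ξ p X) w
      = secondForm κ τ (φ p) (diff φ p X) (ξ p) (diff ξ p X) w := by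
  have h : covDeriv κ τ φ ξ p X = diff ξ p X
      + fun k => ∑ i, ∑ j, christoffel κ τ k i j (φ p) * diff φ p X i * ξ p j := rfl
  rw [h, metric_add_left, metric_christoffel κ τ (hM.mem_space p)]
  rfl

section Derivatives

variable [IsManifold (𝓡 2) ∞ M]

/-- The unit normal differentiated in its normal form. -/
theorem IsOrientedSurface.diff_normal_eq (hM : IsOrientedSurface κ τ φ ξ)
    (hρ : ∀ t p, φ (ρ t p) = rotation t (φ p)) (hr : ∀ p, 0 < radiusSq (φ p)) (p : M)
    (X : TangentSpace (𝓡 2) p) :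
    diff ξ p X = normalVecDeriv κ τ (φ p) (diff φ p X) (radialPart κ φ ξ p)
      (hopfPart κ τ φ ξ p) (dirDeriv (radialPart κ φ ξ) p X)
      (dirDeriv (hopfPart κ τ φ ξ) p X) := by
  have hx := hM.hasDerivAt_coord X 0
  have hy := hM.hasDerivAt_coord X 1
  have hs := hM.hasDerivAt_radiusSq X
  have hμ : HasDerivAt (fun t => radialPart κ φ ξ (chartLine p X t))
      (dirDeriv (radialPart κ φ ξ) p X) 0 :=
    hasDerivAt_chartLine (hM.mdifferentiableAt_radialPart (hr p)) X
  have hc : HasDerivAt (fun t => hopfPart κ τ φ ξ (chartLine p X t))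
      (dirDeriv (hopfPart κ τ φ ξ) p X) 0 :=
    hasDerivAt_chartLine (hM.mdifferentiableAt_hopfPart p) X
  have hF : HasDerivAt (fun t => conf κ (φ (chartLine p X t)))
      (κ / 2 * (φ p 0 * diff φ p X 0 + φ p 1 * diff φ p X 1)) 0 :=
    ((hs.const_mul (κ / 4)).const_add 1).congr_deriv (by ring)
  have hξ : ∀ i, HasDerivAt (fun t => ξ (chartLine p X t) i) (diff ξ p X i) 0 :=
    hasDerivAt_pi.1 (hasDerivAt_chartLine (hM.mdifferentiableAt_normal p) X)
  have hn : ∀ m, ξ m = normalVec κ τ (φ m) (radialPart κ φ ξ m) (hopfPart κ τ φ ξ m) :=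
    fun m => hM.normal_eq hρ (hr m)
  funext i
  fin_cases i
  · have h1 := hξ 0
    have h2 := hF.fun_mul ((hμ.fun_mul hx).fun_sub ((hc.const_mul τ).fun_mul hy))
    rw [funext fun t => congrFun (hn (chartLine p X t)) 0] at h1
    refine (h1.unique h2).trans ?_
    simp only [chartLine_zero]
    dsimp [normalVecDeriv]
    ring
  · have h1 := hξ 1
    have h2 := hF.fun_mul ((hμ.fun_mul hy).fun_add ((hc.const_mul τ).fun_mul hx))
    rw [funext fun t => congrFun (hn (chartLine p X t)) 1] at h1
    refine (h1.unique h2).trans ?_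
    simp only [chartLine_zero]
    dsimp [normalVecDeriv]
    ring
  · have h1 := hξ 2
    have h2 := hc.fun_mul ((hs.const_mul (τ ^ 2)).const_add 1)
    rw [funext fun t => congrFun (hn (chartLine p X t)) 2] at h1
    refine (h1.unique h2).trans ?_
    simp only [chartLine_zero]
    dsimp [normalVecDeriv]

theorem IsOrientedSurface.dirDeriv_unit_eq (hM : IsOrientedSurface κ τ φ ξ)
    (hρ : ∀ t p, φ (ρ t p) = rotation t (φ p)) (hr : ∀ p, 0 < radiusSq (φ p)) (p : M)
    (X : TangentSpace (𝓡 2) p) :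
    (φ p 0 * diff φ p X 0 + φ p 1 * diff φ p X 1)
        * (radialPart κ φ ξ p ^ 2 + τ ^ 2 * hopfPart κ τ φ ξ p ^ 2)
      + radiusSq (φ p) * radialPart κ φ ξ p * dirDeriv (radialPart κ φ ξ) p X
      + (1 + τ ^ 2 * radiusSq (φ p)) * hopfPart κ τ φ ξ p * dirDeriv (hopfPart κ τ φ ξ) p X
        = 0 := by
  have hs := hM.hasDerivAt_radiusSq X
  have hμ : HasDerivAt (fun t => radialPart κ φ ξ (chartLine p X t))
      (dirDeriv (radialPart κ φ ξ) p X) 0 :=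
    hasDerivAt_chartLine (hM.mdifferentiableAt_radialPart (hr p)) X
  have hc : HasDerivAt (fun t => hopfPart κ τ φ ξ (chartLine p X t))
      (dirDeriv (hopfPart κ τ φ ξ) p X) 0 :=
    hasDerivAt_chartLine (hM.mdifferentiableAt_hopfPart p) X
  have h1 := (hs.fun_mul (hμ.fun_pow 2)).fun_add
    ((hc.fun_pow 2).fun_mul ((hs.const_mul (τ ^ 2)).const_add 1))
  rw [funext fun t => hM.unit_eq hρ (hr (chartLine p X t))] at h1
  have h2 := h1.unique (hasDerivAt_const _ _)
  simp only [chartLine_zero] at h2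
  norm_num at h2
  linear_combination h2 / 2

/-- The tangent vector of the meridian through `p`. -/
theorem IsOrientedSurface.exists_meridian (hM : IsOrientedSurface κ τ φ ξ)
    (hρ : ∀ t p, φ (ρ t p) = rotation t (φ p)) (hr : ∀ p, 0 < radiusSq (φ p)) (p : M) :
    ∃ X, diff φ p X
      = meridianVec κ τ (φ p) (radialPart κ φ ξ p) (hopfPart κ τ φ ξ p) := by
  refine hM.exists_diff_eq p ?_
  conv_lhs => rw [hM.normal_eq hρ (hr p)]
  exact metric_normalVec_meridianVec (hM.mem_space p) _ _

theorem IsOrientedSurface.metric_meridian (hM : IsOrientedSurface κ τ φ ξ)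
    (hρ : ∀ t p, φ (ρ t p) = rotation t (φ p)) (hr : ∀ p, 0 < radiusSq (φ p)) {p : M}
    {X : TangentSpace (𝓡 2) p}
    (hX : diff φ p X = meridianVec κ τ (φ p) (radialPart κ φ ξ p) (hopfPart κ τ φ ξ p)) :
    metric κ τ (φ p) (diff φ p X) (diff φ p X)
      = radiusSq (φ p) * (1 + τ ^ 2 * radiusSq (φ p)) := by
  rw [hX, metric_meridianVec (hM.mem_space p), hM.unit_eq hρ (hr p), mul_one]

theorem one_add_sq_pos (τ : ℝ) {s : ℝ} (hs : 0 < s) : 0 < 1 + τ ^ 2 * s := by positivity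

/-- The mean curvature of a surface of revolution, in terms of the derivative of the normal along
the meridian. -/
theorem IsOrientedSurface.meanCurvature_eq (hM : IsOrientedSurface κ τ φ ξ)
    (hρ : ∀ t p, φ (ρ t p) = rotation t (φ p)) (hr : ∀ p, 0 < radiusSq (φ p)) {p : M}
    {X : TangentSpace (𝓡 2) p}
    (hX : diff φ p X = meridianVec κ τ (φ p) (radialPart κ φ ξ p) (hopfPart κ τ φ ξ p)) :
    meanCurvature κ τ φ ξ p
      = radialPart κ φ ξ p * dirDeriv (hopfPart κ τ φ ξ) p X
        - hopfPart κ τ φ ξ p * dirDeriv (radialPart κ φ ξ) p X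
        - radialPart κ φ ξ p * conf κ (φ p) * hopfPart κ τ φ ξ p ^ 2
        - radialPart κ φ ξ p * (1 - κ / 4 * radiusSq (φ p)) := by
  have hq := hM.mem_space p
  have hF : conf κ (φ p) ≠ 0 := ne_of_gt hq
  have hs : radiusSq (φ p) ≠ 0 := (hr p).ne'
  have hE : 1 + τ ^ 2 * radiusSq (φ p) ≠ 0 := (one_add_sq_pos τ (hr p)).ne'
  obtain ⟨Y, hY, hinv⟩ := hM.exists_parallel hρ p
  have hYY : metric κ τ (φ p) (diff φ p Y) (diff φ p Y)
      = radiusSq (φ p) * (1 + τ ^ 2 * radiusSq (φ p)) / conf κ (φ p) ^ 2 := by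
    rw [hY, metric_rotationField hq]
  have hXX := hM.metric_meridian hρ hr hX
  have hYX : metric κ τ (φ p) (diff φ p Y) (diff φ p X) = 0 := by
    rw [hY, hX, metric_rotationField_meridianVec hq]
  have hYY0 : metric κ τ (φ p) (diff φ p Y) (diff φ p Y) ≠ 0 := by
    rw [hYY]
    exact div_ne_zero (mul_ne_zero hs hE) (pow_ne_zero 2 hF)
  have hXX0 : metric κ τ (φ p) (diff φ p X) (diff φ p X) ≠ 0 := by
    rw [hXX]
    exact mul_ne_zero hs hE
  have hY1 : dirDeriv (radialPart κ φ ξ) p Y = 0 := hinv _ fun t => hM.radialPart_flow hρ t p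
  have hY2 : dirDeriv (hopfPart κ τ φ ξ) p Y = 0 := hinv _ fun t => hM.hopfPart_flow hρ t p
  rw [meanCurvature, trace_eq_of_orthogonal hYY0 hXX0 hYX, hYY, hXX, hM.metric_shapeOperator,
    hM.metric_shapeOperator, hM.metric_covDeriv_eq, hM.metric_covDeriv_eq,
    hM.diff_normal_eq hρ hr, hM.diff_normal_eq hρ hr, hY1, hY2, hM.normal_eq hρ (hr p), hX, hY,
    secondForm_rotationField hq, secondForm_meridian hq, hM.unit_eq hρ (hr p)]
  generalize 1 + τ ^ 2 * radiusSq (φ p) = E at hE ⊢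
  field_simp
  ring

theorem meridianVec_rotation (κ τ t : ℝ) (q : R3) (μ c : ℝ) :
    meridianVec κ τ (rotation t q) μ c = rotation t (meridianVec κ τ q μ c) := by
  have h : radiusSq (rotation t q) = radiusSq q := rotation_sq t q
  funext i
  fin_cases i <;> simp [meridianVec, h, conf_rotation] <;> simp [rotation] <;> ring

theorem IsOrientedSurface.dirDeriv_flow (hM : IsOrientedSurface κ τ φ ξ)
    (hρ : ∀ t p, φ (ρ t p) = rotation t (φ p)) {h : M → ℝ} {t : ℝ} {p : M}
    (hinv : ∀ m, h (ρ t m) = h m) (hd : MDifferentiableAt (𝓡 2) 𝓘(ℝ, ℝ) h (ρ t p))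
    (hd' : MDifferentiableAt (𝓡 2) 𝓘(ℝ, ℝ) h p)
    (X : TangentSpace (𝓡 2) p) :
    dirDeriv h (ρ t p) (mfderiv (𝓡 2) (𝓡 2) (ρ t) p X) = dirDeriv h p X := by
  have h1 := hd.hasMFDerivAt.comp p (hM.mdifferentiableAt_flow hρ t p).hasMFDerivAt
  rw [show h ∘ ρ t = h from funext hinv] at h1
  exact DFunLike.congr_fun (hasMFDerivAt_unique h1 hd'.hasMFDerivAt) X

theorem IsOrientedSurface.meanCurvature_flow (hM : IsOrientedSurface κ τ φ ξ)
    (hρ : ∀ t p, φ (ρ t p) = rotation t (φ p)) (hr : ∀ p, 0 < radiusSq (φ p)) (t : ℝ) (p : M) :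
    meanCurvature κ τ φ ξ (ρ t p) = meanCurvature κ τ φ ξ p := by
  obtain ⟨X, hX⟩ := hM.exists_meridian hρ hr p
  have hμ := hM.radialPart_flow hρ t
  have hc := hM.hopfPart_flow hρ t
  have hX' : diff φ (ρ t p) (mfderiv (𝓡 2) (𝓡 2) (ρ t) p X)
      = meridianVec κ τ (φ (ρ t p)) (radialPart κ φ ξ (ρ t p)) (hopfPart κ τ φ ξ (ρ t p)) := by
    rw [hM.diff_flow hρ, hX, hρ, meridianVec_rotation, hμ, hc]
  rw [hM.meanCurvature_eq hρ hr hX', hM.meanCurvature_eq hρ hr hX, hμ, hc,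
    hM.dirDeriv_flow hρ hμ (hM.mdifferentiableAt_radialPart (hr _))
      (hM.mdifferentiableAt_radialPart (hr _)),
    hM.dirDeriv_flow hρ hc (hM.mdifferentiableAt_hopfPart _) (hM.mdifferentiableAt_hopfPart _),
    hρ, conf_rotation, show radiusSq (rotation t (φ p)) = radiusSq (φ p) from rotation_sq t _]

end Derivatives

end NormalDerivative

section Equation

variable {M : Type*} [TopologicalSpace M] [ChartedSpace R2 M]
variable {κ τ : ℝ} {φ ξ : M → R3} {ρ : Flow ℝ M}

/-! ### The biconservative equation on a surface of revolution -/

theorem dirDeriv_const_mul {h : M → ℝ} {p : M} (hh : MDifferentiableAt (𝓡 2) 𝓘(ℝ, ℝ) h p) (a : ℝ)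
    (X : TangentSpace (𝓡 2) p) : dirDeriv (fun m => a * h m) p X = a * dirDeriv h p X := by
  have h1 : MDifferentiableAt (𝓡 2) 𝓘(ℝ, ℝ) (fun m => a * h m) p := hh.const_smul a
  exact (hasDerivAt_chartLine h1 X).unique ((hasDerivAt_chartLine hh X).const_mul a)

theorem IsOrientedSurface.eq_zero_of_metric (hM : IsOrientedSurface κ τ φ ξ) {p : M}
    {W : TangentSpace (𝓡 2) p}
    (hW : ∀ Y, metric κ τ (φ p) (diff φ p W) (diff φ p Y) = 0) : W = 0 :=
  hM.immersion p ((eq_zero_of_metric_self κ τ (hM.mem_space p) (hW W)).trans (map_zero _).symm)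

theorem IsOrientedSurface.metric_ricciVec_normal (hM : IsOrientedSurface κ τ φ ξ) (p : M)
    (Y : TangentSpace (𝓡 2) p) :
    metric κ τ (φ p) (ricciVec κ τ (φ p) (ξ p)) (diff φ p Y)
      = (4 * τ ^ 2 - κ) * (hopfPart κ τ φ ξ p * contactForm κ τ (φ p) (diff φ p Y)) := by
  rw [metric_ricciVec κ τ (hM.mem_space p), hM.normal, mul_zero, zero_add, hopfPart]

section Biconservative

variable [IsManifold (𝓡 2) ∞ M]

/-- On a biconservative surface of revolution, the component of the equation along the parallel
gives the derivative of `f` along the meridian, and then the component along the meridian shows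
that `f` is a multiple of `radialPart` wherever `cos α ≠ 0`. The mixed term of the second
fundamental form contains the factor `τ (4 τ² - κ)`, which has to be cancelled. -/
theorem IsOrientedSurface.biconservative_system (hM : IsOrientedSurface κ τ φ ξ)
    (hκτ : κ ≠ 4 * τ ^ 2) (hτ : τ ≠ 0)
    (hρ : ∀ t p, φ (ρ t p) = rotation t (φ p)) (hr : ∀ p, 0 < radiusSq (φ p))
    (hf : ∀ p, meanCurvature κ τ φ ξ p ≠ 0) (hb : IsBiconservative κ τ φ ξ) {p : M}
    {X : TangentSpace (𝓡 2) p}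
    (hX : diff φ p X = meridianVec κ τ (φ p) (radialPart κ φ ξ p) (hopfPart κ τ φ ξ p)) :
    dirDeriv (meanCurvature κ τ φ ξ) p X
        = -4 * meanCurvature κ τ φ ξ p * hopfPart κ τ φ ξ p * (1 + τ ^ 2 * radiusSq (φ p)) ∧
      (hopfPart κ τ φ ξ p ≠ 0 →
        meanCurvature κ τ φ ξ p = -(2 / 3) * radialPart κ φ ξ p) := by
  have hq := hM.mem_space p
  have hF : conf κ (φ p) ≠ 0 := ne_of_gt hq
  have hF' : conf κ (φ p) = 1 + κ / 4 * radiusSq (φ p) := rfl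
  have hs : radiusSq (φ p) ≠ 0 := (hr p).ne'
  have hE : 1 + τ ^ 2 * radiusSq (φ p) ≠ 0 := (one_add_sq_pos τ (hr p)).ne'
  obtain ⟨Y, hY, hinv⟩ := hM.exists_parallel hρ p
  have hYY : metric κ τ (φ p) (diff φ p Y) (diff φ p Y)
      = radiusSq (φ p) * (1 + τ ^ 2 * radiusSq (φ p)) / conf κ (φ p) ^ 2 := by
    rw [hY, metric_rotationField hq]
  have hXX := hM.metric_meridian hρ hr hX
  have hYX : metric κ τ (φ p) (diff φ p Y) (diff φ p X) = 0 := by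
    rw [hY, hX, metric_rotationField_meridianVec hq]
  have hYY0 : metric κ τ (φ p) (diff φ p Y) (diff φ p Y) ≠ 0 := by
    rw [hYY]
    exact div_ne_zero (mul_ne_zero hs hE) (pow_ne_zero 2 hF)
  have hXX0 : metric κ τ (φ p) (diff φ p X) (diff φ p X) ≠ 0 := by
    rw [hXX]
    exact mul_ne_zero hs hE
  have hDY : dirDeriv (meanCurvature κ τ φ ξ) p Y = 0 :=
    hinv _ fun t => hM.meanCurvature_flow hρ hr t p
  set D := dirDeriv (meanCurvature κ τ φ ξ) p X with hD
  have hgrad : grad κ τ φ (meanCurvature κ τ φ ξ) p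
      = (D / (radiusSq (φ p) * (1 + τ ^ 2 * radiusSq (φ p)))) • X := by
    refine hM.eq_of_metric_eq hYY0 hXX0 hYX ?_ ?_
    · rw [hM.metric_grad, map_smul, metric_smul_left, metric_comm κ τ _ _ (diff φ p Y), hYX, hDY,
        mul_zero]
    · rw [hM.metric_grad, map_smul, metric_smul_left, hXX, ← hD, div_mul_cancel₀]
      exact mul_ne_zero hs hE
  have hpair : ∀ Z : TangentSpace (𝓡 2) p,
      2 * (D / (radiusSq (φ p) * (1 + τ ^ 2 * radiusSq (φ p)))
          * secondForm κ τ (φ p) (diff φ p X) (ξ p) (diff ξ p X) (diff φ p Z))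
        + meanCurvature κ τ φ ξ p
          * dirDeriv (meanCurvature κ τ φ ξ) p Z
        = 2 * meanCurvature κ τ φ ξ p * ((4 * τ ^ 2 - κ)
          * (hopfPart κ τ φ ξ p * contactForm κ τ (φ p) (diff φ p Z))) := by
    intro Z
    have h := congrArg (fun W => metric κ τ (φ p) (diff φ p W) (diff φ p Z)) (hb p)
    simp only [map_add, map_smul, metric_add_left, metric_smul_left, hM.metric_tangentPart,
      hM.metric_ricciVec_normal, hM.metric_grad] at h
    rw [hgrad, map_smul, map_smul, metric_smul_left, hM.metric_shapeOperator,
      hM.metric_covDeriv_eq] at h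
    exact h
  have h1 := hpair Y
  rw [hDY, hM.diff_normal_eq hρ hr, hM.normal_eq hρ (hr p), hX, hY,
    secondForm_meridian_parallel hq, hM.unit_eq hρ (hr p), contactForm_rotationField] at h1
  have hc4 : 4 * τ ^ 2 - κ ≠ 0 := sub_ne_zero.2 hκτ.symm
  have h1' : D = -4 * meanCurvature κ τ φ ξ p * hopfPart κ τ φ ξ p
      * (1 + τ ^ 2 * radiusSq (φ p)) := by
    generalize 1 + τ ^ 2 * radiusSq (φ p) = E at hE h1 ⊢
    field_simp at h1
    refine mul_left_cancel₀ (mul_ne_zero (mul_ne_zero hs hτ) hc4) ?_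
    linear_combination h1 / 2
  refine ⟨h1', fun hc => ?_⟩
  have h2 := hpair X
  rw [← hD, hM.diff_normal_eq hρ hr, hM.normal_eq hρ (hr p), hX,
    secondForm_meridian hq, hM.unit_eq hρ (hr p), contactForm_meridianVec hq, h1'] at h2
  have h3 := hM.meanCurvature_eq hρ hr hX
  have hfp := hf p
  clear_value D
  generalize meanCurvature κ τ φ ξ p = f at *
  generalize radialPart κ φ ξ p = μ at *
  generalize hopfPart κ τ φ ξ p = c at *
  generalize radiusSq (φ p) = s at *
  obtain ⟨E, hEdef⟩ : ∃ E, E = 1 + τ ^ 2 * s := ⟨_, rfl⟩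
  rw [← hEdef] at h2 hE
  have h4 : 4 * (E * (f + μ * (1 - κ / 4 * s)) + s * μ * conf κ (φ p) * τ ^ 2) + 2 * f * E
      = (4 * τ ^ 2 - κ) * s * μ := by
    have h5 : ∀ w, -4 * f * c * E / (s * E) * (s * w) = -4 * f * c * w := by
      intro w
      field_simp
    rw [h5] at h2
    refine mul_left_cancel₀ (mul_ne_zero hfp hc) ?_
    linear_combination (-1 / 2) * h2 + 4 * E * f * c * h3
  rw [hF'] at h4
  refine mul_left_cancel₀ hE ?_
  rw [hEdef] at h4 ⊢
  linear_combination h4 / 6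

/-- On a biconservative surface of revolution with `f ≠ 0`, the Hopf field is tangent to the
surface: near a point with `cos α ≠ 0`, the two equations of the system determine the derivatives
of `radialPart` and of `cos α`, which are incompatible with the formula for the mean curvature. -/
theorem IsOrientedSurface.hopfPart_eq_zero (hM : IsOrientedSurface κ τ φ ξ)
    (hκτ : κ ≠ 4 * τ ^ 2) (hτ : τ ≠ 0)
    (hρ : ∀ t p, φ (ρ t p) = rotation t (φ p)) (hr : ∀ p, 0 < radiusSq (φ p))
    (hf : ∀ p, meanCurvature κ τ φ ξ p ≠ 0) (hb : IsBiconservative κ τ φ ξ) (p : M) :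
    hopfPart κ τ φ ξ p = 0 := by
  by_contra hc
  obtain ⟨X, hX⟩ := hM.exists_meridian hρ hr p
  obtain ⟨h1, h2⟩ := hM.biconservative_system hκτ hτ hρ hr hf hb hX
  have hcont := (hM.mdifferentiableAt_hopfPart p).continuousAt
  have h3 : meanCurvature κ τ φ ξ =ᶠ[nhds p] fun m => -(2 / 3) * radialPart κ φ ξ m := by
    filter_upwards [hcont.eventually_ne hc] with m hm
    obtain ⟨Z, hZ⟩ := hM.exists_meridian hρ hr m
    exact (hM.biconservative_system hκτ hτ hρ hr hf hb hZ).2 hm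
  have h4 : dirDeriv (meanCurvature κ τ φ ξ) p X
      = -(2 / 3) * dirDeriv (radialPart κ φ ξ) p X := by
    rw [← dirDeriv_const_mul (hM.mdifferentiableAt_radialPart (hr p)), dirDeriv, h3.mfderiv_eq]
    rfl
  have h5 := hM.meanCurvature_eq hρ hr hX
  have h6 := hM.dirDeriv_unit_eq hρ hr p X
  have h7 := hM.unit_eq hρ (hr p)
  have hfp := hf p
  have h8 : φ p 0 * diff φ p X 0 + φ p 1 * diff φ p X 1
      = (1 + τ ^ 2 * radiusSq (φ p)) * conf κ (φ p) * hopfPart κ τ φ ξ p * radiusSq (φ p) := by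
    rw [hX]
    simp [meridianVec, radiusSq]
    ring
  have hF' : conf κ (φ p) = 1 + κ / 4 * radiusSq (φ p) := rfl
  have hE : 1 + τ ^ 2 * radiusSq (φ p) ≠ 0 := (one_add_sq_pos τ (hr p)).ne'
  rw [h8] at h6
  rw [h2 hc] at h1 h5 hfp
  rw [h4] at h1
  generalize meanCurvature κ τ φ ξ p = f at *
  generalize dirDeriv (radialPart κ φ ξ) p X = μ' at *
  generalize dirDeriv (hopfPart κ τ φ ξ) p X = c' at *
  generalize radialPart κ φ ξ p = μ at *
  generalize hopfPart κ τ φ ξ p = c at *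
  have hμ : μ ≠ 0 := fun h => hfp (by rw [h, mul_zero])
  -- The two equations and the derivative of the unit length condition determine `μ'` and `c'`.
  have h9 : μ' = -4 * μ * c * (1 + τ ^ 2 * radiusSq (φ p)) := by linear_combination (-3 / 2) * h1
  have h10 : c' = 4 * radiusSq (φ p) * μ ^ 2 - conf κ (φ p) * (1 - c ^ 2) := by
    rw [h9] at h6
    refine mul_left_cancel₀ (mul_ne_zero hE hc) ?_
    linear_combination h6 - (1 + τ ^ 2 * radiusSq (φ p)) * c * conf κ (φ p) * h7
  rw [h9, h10] at h5
  have h11 : μ * (8 / 3) = 0 := by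
    linear_combination -h5 - 4 * μ * h7 + μ * hF'
  exact hμ (by linarith)

end Biconservative

/-! ### Hopf circular cylinders -/

theorem exists_rotation_eq {u v : R3} (hu : 0 < radiusSq u) (h : radiusSq u = radiusSq v)
    (h2 : u 2 = v 2) : ∃ t, rotation t u = v := by
  let z : ℂ := ⟨(u 0 * v 0 + u 1 * v 1) / radiusSq u, (u 0 * v 1 - u 1 * v 0) / radiusSq u⟩
  have hn : ‖z‖ = 1 := by
    rw [← sq_eq_sq₀ (norm_nonneg _) zero_le_one, Complex.sq_norm, Complex.normSq_apply]
    simp only [z]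
    have : (u 0 * v 0 + u 1 * v 1) * (u 0 * v 0 + u 1 * v 1)
        + (u 0 * v 1 - u 1 * v 0) * (u 0 * v 1 - u 1 * v 0) = radiusSq u * radiusSq u := by
      nth_rewrite 2 [h]
      simp only [radiusSq]
      ring
    field_simp
    linear_combination this
  have hz : z ≠ 0 := fun h0 => by simp [h0] at hn
  have hcos : Real.cos z.arg = (u 0 * v 0 + u 1 * v 1) / radiusSq u := by
    rw [Complex.cos_arg hz, hn, div_one]
  have hsin : Real.sin z.arg = (u 0 * v 1 - u 1 * v 0) / radiusSq u := by
    rw [Complex.sin_arg, hn, div_one]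
  refine ⟨z.arg, ?_⟩
  funext i
  fin_cases i
  · simp [rotation, hcos, hsin]
    field_simp
    simp only [radiusSq]
    ring
  · simp [rotation, hcos, hsin]
    field_simp
    simp only [radiusSq]
    ring
  · exact h2

section Cylinder

variable [IsManifold (𝓡 2) ∞ M]

theorem IsOrientedSurface.isHopfCircularCylinder [ConnectedSpace M]
    (hM : IsOrientedSurface κ τ φ ξ)
    (hρ : ∀ t p, φ (ρ t p) = rotation t (φ p)) (hr : ∀ p, 0 < radiusSq (φ p))
    (hc : ∀ p, hopfPart κ τ φ ξ p = 0) : IsHopfCircularCylinder φ := by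
  have hμ : ∀ p, radialPart κ φ ξ p ≠ 0 := by
    intro p h0
    have h := hM.unit_eq hρ (hr p)
    rw [hc, h0] at h
    norm_num at h
  have hd : ∀ p (X : TangentSpace (𝓡 2) p),
      φ p 0 * diff φ p X 0 + φ p 1 * diff φ p X 1 = 0 := by
    intro p X
    have hF : conf κ (φ p) ≠ 0 := ne_of_gt (hM.mem_space p)
    have h := hM.normal p X
    rw [metric, show contactForm κ τ (φ p) (ξ p) = 0 from hc p, hM.normal_eq hρ (hr p), hc] at h
    simp [normalVec] at h
    rcases h with h | h
    · refine mul_left_cancel₀ (mul_ne_zero hF (hμ p)) ?_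
      linear_combination h
    · exact absurd h hF
  have hconst : ∀ p q, radiusSq (φ p) = radiusSq (φ q) := by
    refine eq_of_mfderiv_eq_zero fun p => ?_
    have h1 : MDifferentiableAt (𝓡 2) 𝓘(ℝ, ℝ) (fun m => radiusSq (φ m)) p := by
      have h2 : DifferentiableAt ℝ radiusSq (φ p) := by
        unfold radiusSq
        fun_prop
      exact MDifferentiableAt.comp (I' := 𝓘(ℝ, R3)) p h2.mdifferentiableAt
        (hM.mdifferentiableAt p)
    have h2 : mfderiv (𝓡 2) 𝓘(ℝ, ℝ) (fun m => radiusSq (φ m)) p = 0 := by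
      refine ContinuousLinearMap.ext fun X => ?_
      refine ((hasDerivAt_chartLine h1 X).unique (hM.hasDerivAt_radiusSq X)).trans ?_
      rw [hd, mul_zero]
      rfl
    rw [← h2]
    exact h1.hasMFDerivAt
  obtain ⟨p₀⟩ : Nonempty M := inferInstance
  have hz : Continuous fun m => φ m 2 := (continuous_apply 2).comp hM.smooth.continuous
  refine ⟨Real.sqrt (radiusSq (φ p₀)), Real.sqrt_pos.2 (hr p₀), Set.range fun m => φ m 2, ?_,
    (isPreconnected_range hz).ordConnected, ?_⟩
  -- The height is a submersion, because the meridian is vertical.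
  · rw [isOpen_iff_mem_nhds]
    rintro _ ⟨p, rfl⟩
    have h1 : ContMDiffAt (𝓡 2) 𝓘(ℝ, ℝ) ∞ (fun m => φ m 2) p := by
      have h2 : ContDiff ℝ ∞ fun q : R3 => q 2 := by fun_prop
      exact h2.contMDiff.contMDiffAt.comp p (hM.smooth p)
    obtain ⟨X, hX⟩ := hM.exists_meridian hρ hr p
    have h2 : (show ℝ from mfderiv (𝓡 2) 𝓘(ℝ, ℝ) (fun m => φ m 2) p X)
        = -(radiusSq (φ p) * radialPart κ φ ξ p * (1 + τ ^ 2 * radiusSq (φ p))) := by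
      refine ((hasDerivAt_chartLine (h1.mdifferentiableAt (by simp)) X).unique
        (hM.hasDerivAt_coord X 2)).trans ?_
      rw [hX]
      rfl
    have h3 : (show ℝ from mfderiv (𝓡 2) 𝓘(ℝ, ℝ) (fun m => φ m 2) p X) ≠ 0 := by
      rw [h2]
      exact neg_ne_zero.2 (mul_ne_zero (mul_ne_zero (hr p).ne' (hμ p))
        (one_add_sq_pos τ (hr p)).ne')
    have h4 := hasStrictFDerivAt_chart h1
    have h5 := h4.map_nhds_eq_of_surj (LinearMap.range_eq_top.2 fun a =>
      ⟨(a / (show ℝ from mfderiv (𝓡 2) 𝓘(ℝ, ℝ) (fun m => φ m 2) p X)) • (show R2 from X), by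
        refine (map_smul (show R2 →L[ℝ] ℝ from mfderiv (𝓡 2) 𝓘(ℝ, ℝ) (fun m => φ m 2) p)
          _ (show R2 from X)).trans ?_
        exact div_mul_cancel₀ a h3⟩)
    simp only [Function.comp_apply, extChartAt_to_inv] at h5
    rw [← h5]
    refine Filter.mem_of_superset Filter.range_mem_map ?_
    rintro _ ⟨y, rfl⟩
    exact ⟨_, rfl⟩
  · rw [Real.sq_sqrt (hr p₀).le]
    ext q
    constructor
    · rintro ⟨m, rfl⟩
      exact ⟨hconst m p₀, m, rfl⟩
    · rintro ⟨hq, m, hm⟩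
      obtain ⟨t, ht⟩ := exists_rotation_eq (hr m) ((hconst m p₀).trans hq.symm) hm
      exact ⟨ρ t m, by rw [hρ, ht]⟩

/-- A surface on a circular cylinder contains the Hopf field, its mean curvature is locally constant
and `Ricci(ξ)` is normal to it, so that both sides of the biconservative equation vanish. -/
theorem IsOrientedSurface.isBiconservative_of_radiusSq_eq (hM : IsOrientedSurface κ τ φ ξ)
    (hρ : ∀ t p, φ (ρ t p) = rotation t (φ p)) (hr : ∀ p, 0 < radiusSq (φ p)) {s : ℝ}
    (hs : ∀ p, radiusSq (φ p) = s) : IsBiconservative κ τ φ ξ := by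
  have hd : ∀ p (X : TangentSpace (𝓡 2) p),
      φ p 0 * diff φ p X 0 + φ p 1 * diff φ p X 1 = 0 := by
    intro p X
    have h1 := hM.hasDerivAt_radiusSq X
    rw [funext fun t => hs (chartLine p X t)] at h1
    have h2 := h1.unique (hasDerivAt_const _ _)
    linarith
  have hc : ∀ p, hopfPart κ τ φ ξ p = 0 := by
    intro p
    obtain ⟨X, hX⟩ := hM.exists_meridian hρ hr p
    have h1 := hd p X
    have h2 : φ p 0 * diff φ p X 0 + φ p 1 * diff φ p X 1
        = (1 + τ ^ 2 * radiusSq (φ p)) * conf κ (φ p) * radiusSq (φ p)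
          * hopfPart κ τ φ ξ p := by
      rw [hX]
      simp [meridianVec, radiusSq]
      ring
    rw [h2] at h1
    refine (mul_eq_zero.1 h1).resolve_left (mul_ne_zero (mul_ne_zero ?_ ?_) (hr p).ne')
    · exact (one_add_sq_pos τ (hr p)).ne'
    · exact ne_of_gt (hM.mem_space p)
  have hμ : ∀ p (X : TangentSpace (𝓡 2) p), dirDeriv (radialPart κ φ ξ) p X = 0 := by
    intro p X
    have h1 := hM.dirDeriv_unit_eq hρ hr p X
    have h2 := hM.unit_eq hρ (hr p)
    rw [hd, hc] at h1
    rw [hc] at h2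
    have h3 : radialPart κ φ ξ p ≠ 0 := by
      intro h0
      rw [h0] at h2
      norm_num at h2
    refine mul_left_cancel₀ (mul_ne_zero (hr p).ne' h3) ?_
    linear_combination h1
  have hc' : ∀ p (X : TangentSpace (𝓡 2) p), dirDeriv (hopfPart κ τ φ ξ) p X = 0 := by
    intro p X
    rw [dirDeriv, show hopfPart κ τ φ ξ = fun _ => 0 from funext hc, mfderiv_const]
    rfl
  have hf : meanCurvature κ τ φ ξ = fun p => -(1 - κ / 4 * s) * radialPart κ φ ξ p := by
    funext p
    obtain ⟨X, hX⟩ := hM.exists_meridian hρ hr p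
    rw [hM.meanCurvature_eq hρ hr hX, hμ, hc', hc, hs]
    ring
  have hgrad : ∀ p, grad κ τ φ (meanCurvature κ τ φ ξ) p = 0 := by
    intro p
    refine hM.eq_zero_of_metric fun Y => ?_
    rw [hM.metric_grad, hf]
    refine (dirDeriv_const_mul (hM.mdifferentiableAt_radialPart (hr p)) _ Y).trans ?_
    rw [hμ, mul_zero]
  intro p
  have hRic : tangentPart κ τ φ p (ricciVec κ τ (φ p) (ξ p)) = 0 := by
    refine hM.eq_zero_of_metric fun Y => ?_
    rw [hM.metric_tangentPart, hM.metric_ricciVec_normal, hc]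
    ring
  rw [hgrad, hRic, map_zero, smul_zero, smul_zero, smul_zero, add_zero]

end Cylinder

end Equation

end BCV

end

theorem theorem5p2 (κ τ : ℝ) (hκτ : κ ≠ 4 * τ ^ 2) (hτ : τ ≠ 0)
    {M : Type*} [TopologicalSpace M] [ChartedSpace BCV.R2 M] [IsManifold (𝓡 2) ∞ M]
    [ConnectedSpace M]
    (φ ξ : M → BCV.R3)
    (hM : BCV.IsOrientedSurface κ τ φ ξ)
    (hrev : BCV.IsSurfaceOfRevolution φ)
    (hf : ∀ p, BCV.meanCurvature κ τ φ ξ p ≠ 0)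
    (hα : ∀ p, BCV.angle κ τ φ ξ p ∈ Set.Ioo 0 Real.pi) :
    BCV.IsBiconservative κ τ φ ξ ↔ BCV.IsHopfCircularCylinder φ := by
  obtain ⟨ρ, hρ⟩ := hrev
  have hr := hM.radiusSq_pos hρ hα
  constructor
  · intro hb
    exact hM.isHopfCircularCylinder hρ hr (hM.hopfPart_eq_zero hκτ hτ hρ hr hf hb)
  · rintro ⟨R, -, J, -, -, hJ⟩
    refine hM.isBiconservative_of_radiusSq_eq hρ hr (s := R ^ 2) fun p => ?_
    have h : φ p ∈ Set.range φ := ⟨p, rfl⟩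
    rw [hJ] at h
    exact h.1
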